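/- **Setting.** Let $(\Omega,\mathcal F,P)$ be a probability space, $(\mathcal X,p)$ a probability space, and $\mathbb R^{d}$, $d\ge 1$, with points $s=(s_1,\dots,s_d)$, where $s_1$ is time and $(s_2,\dots,s_d)$ is space. Put $c(dx,ds)=p(dx)\,ds$ on $\mathcal X\times\mathbb R^d$, and let $\mathcal B_b$ be the class of measurable sets $A$ with $c(A)<\infty$. Let $W=\{W(A):A\in\mathcal B_b\}$ be a standard Gaussian independently scattered random measure: each $W(A)$ is $N(0,c(A))$; for disjoint $A_1,A_2,\ldots\in\mathcal B_b$ the variables $W(A_n)$ are independent; and if also $\bigcup_n A_n\in\mathcal B_b$, then $W(\bigcup_n A_n)=\sum_n W(A_n)$ almost surely. Let $(\mathcal F_r)_{r\in\mathbb R}$ be a filtration relative to which $W$ has independent increments in time: for every $r\in\mathbb R$, $W(A)$ is $\mathcal F_r$-measurable for all $A\in\mathcal B_b$ with $A\subset\{(x,s):s_1\le r\}$, and $\mathcal F_r$ is independent of $\{W(A): A\in\mathcal B_b,\ A\subset\{(x,s):s_1>r\}\}$. The predictable $\sigma$-algebra on $\mathbb R\times\Omega$ is generated by the sets $(a,b]\times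 F$ with $F\in\mathcal F_a$. A process $\varphi$ on $\mathcal X\times\mathbb R^d\times\Omega$ has *Walsh integral* $I=\int\varphi\,dW\in L^2(P)$ if there are finite sums $\varphi_n$ of functions $Y(\omega)\mathbf 1_{(a,b]}(s_1)\mathbf 1_A(x,s_2,\dots,s_d)$, with $Y$ bounded and $\mathcal F_a$-measurable and $A$ measurable of finite $p\otimes\mathrm{Leb}_{d-1}$-measure, such that $\varphi_n\to\varphi$ in $L^2(c\otimes P)$ and the corresponding sums $\sum Y\,W(\{(x,s): s_1\in(a,b],\ (x,s_2,\dots,s_d)\in A\})$ converge to $I$ in $L^2(P)$. **Proposition (Existence).** Let $g:\mathcal X\times\mathbb R^d\to\mathbb R$ be measurable, and let $\sigma=(\sigma(s))_{s\in\mathbb R^d}$ be a strictly stationary real random field that is independent of $W$ and predictable in time, i.e. measurable, as a function of $((s_1,\omega),(s_2,\dots,s_d))$, for the product of the predictable $\sigma$-algebra and the Borel $\sigma$-algebra of $\mathbb R^{d-1}$. Suppose that for all $t\in\mathbb R^d$ $$\int_{\mathcal X\times\mathbb R^d} g^2(x,t-s)\,\mathbb E\big(\sigma^2(s)\big)\,p(dx)\,ds<\infty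 .$$ Then the random field $$X(t)=\int_{\mathcal X\times\mathbb R^d} g(x,t-s)\,\sigma(s)\,W(dx,ds),\qquad t\in\mathbb R^d,$$ is well defined: for every $t$ the Walsh integral exists, and it is unique up to almost sure equality. Moreover, $X$ is strictly stationary (its finite-dimensional distributions are invariant under translations of $\mathbb R^d$) and second-order stationary ($\mathbb E X(t)^2<\infty$, and the mean and covariance functions are invariant under translations of $\mathbb R^d$). -/

import Mathlib

open MeasureTheory ProbabilityTheory Filter Topology
open scoped ENNReal

noncomputable section

namespace VMMMA

/-- Points of `ℝ^(d+1)`: the coordinate `s 0` is time, `Fin.tail s` is space. -/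
abbrev SpaceTime (d : ℕ) : Type := Fin (d + 1) → ℝ

/-- The control measure `c(dx, ds) = p(dx) ds` on `𝒳 × ℝ^(d+1)`. -/
def control {𝒳 : Type*} [MeasurableSpace 𝒳] (p : Measure 𝒳) (d : ℕ) :
    Measure (𝒳 × SpaceTime d) :=
  p.prod volume

/-- A measurable set of finite measure. -/
def IsBounded {E : Type*} [MeasurableSpace E] (c : Measure E) (A : Set E) : Prop :=
  MeasurableSet A ∧ c A < ∞

/-- `W` is a standard Gaussian independently scattered random measure (Gaussian Lévy basis with
characteristic quadruplet `(0, 1, 0, c)`), indexed by the measurable sets of finite `c`-measure.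
The values of `W` on other sets are irrelevant. The countable additivity is almost sure
convergence of the partial sums, for each fixed disjoint sequence. -/
structure IsGaussianBasis {E Ω : Type*} [MeasurableSpace E] [MeasurableSpace Ω]
    (c : Measure E) (P : Measure Ω) (W : Set E → Ω → ℝ) : Prop where
  measurable : ∀ A, IsBounded c A → Measurable (W A)
  law : ∀ A, IsBounded c A → P.map (W A) = gaussianReal 0 (c A).toNNReal
  indep : ∀ A : ℕ → Set E, (∀ n, IsBounded c (A n)) → Pairwise (Function.onFun Disjoint A) →
    iIndepFun (fun n => W (A n)) P
  additive : ∀ A : ℕ → Set E, (∀ n, IsBounded c (A n)) → Pairwise (Function.onFun Disjoint A) →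
    IsBounded c (⋃ n, A n) →
    ∀ᵐ ω ∂P, Tendsto (fun n => ∑ k ∈ Finset.range n, W (A k) ω) atTop (𝓝 (W (⋃ n, A n) ω))

/-- The random field `σ` and the random measure `W` are independent. -/
def IndepOfBasis {T E Ω : Type*} [MeasurableSpace E] [MeasurableSpace Ω]
    (c : Measure E) (P : Measure Ω) (W : Set E → Ω → ℝ) (σ : T → Ω → ℝ) : Prop :=
  IndepFun (fun ω (s : T) => σ s ω) (fun ω (A : {A : Set E // IsBounded c A}) => W A ω) P

/-- `𝓕` is a filtration in time relative to which `W` is a martingale measure with independent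
increments: `W` on the past up to time `t` is `𝓕 t`-measurable, and `W` on the time after `t` is
independent of `𝓕 t`. -/
structure IsNoiseFiltration {𝒳 Ω : Type*} [MeasurableSpace 𝒳] {mΩ : MeasurableSpace Ω} {d : ℕ}
    (p : Measure 𝒳) (P : Measure Ω) (W : Set (𝒳 × SpaceTime d) → Ω → ℝ)
    (𝓕 : Filtration ℝ mΩ) : Prop where
  adapted : ∀ (t : ℝ) (A : Set (𝒳 × SpaceTime d)), IsBounded (control p d) A →
    A ⊆ {z | z.2 0 ≤ t} → Measurable[𝓕 t] (W A)
  indep : ∀ t : ℝ, Indep (𝓕 t)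
    (⨆ A ∈ {A : Set (𝒳 × SpaceTime d) | IsBounded (control p d) A ∧ A ⊆ {z | t < z.2 0}},
      MeasurableSpace.comap (W A) inferInstance) P

/-- The predictable σ-algebra on `ℝ × Ω`, generated by the sets `(a, b] × F` with `F ∈ 𝓕 a`. -/
@[reducible] def predictable {Ω : Type*} {mΩ : MeasurableSpace Ω} (𝓕 : Filtration ℝ mΩ) :
    MeasurableSpace (ℝ × Ω) :=
  MeasurableSpace.generateFrom
    {S | ∃ (a b : ℝ) (F : Set Ω), MeasurableSet[𝓕 a] F ∧ S = Set.Ioc a b ×ˢ F}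

/-- The field `σ` is predictable in the time component: as a function of `((s₀, ω), (s₁, …, s_d))`
it is measurable for the product of the predictable and the Borel σ-algebra. -/
def IsPredictableField {Ω : Type*} {mΩ : MeasurableSpace Ω} {d : ℕ} (𝓕 : Filtration ℝ mΩ)
    (σ : SpaceTime d → Ω → ℝ) : Prop :=
  Measurable[(predictable 𝓕).prod (inferInstance : MeasurableSpace (Fin d → ℝ))]
    (fun q : (ℝ × Ω) × (Fin d → ℝ) => σ (Fin.cons q.1.1 q.2) q.1.2)

/-- The set of all `(x, s)` with `s₀ ∈ (a, b]` and `(x, (s₁, …, s_d)) ∈ A`. -/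
def slab {𝒳 : Type*} {d : ℕ} (a b : ℝ) (A : Set (𝒳 × (Fin d → ℝ))) : Set (𝒳 × SpaceTime d) :=
  {z | z.2 0 ∈ Set.Ioc a b ∧ (z.1, Fin.tail z.2) ∈ A}

/-- An elementary integrand `Y(ω) 1_{(a, b]}(s₀) 1_A(x, s₁, …, s_d)`, with `Y` bounded and
`𝓕 a`-measurable and `A` of finite measure. -/
structure Elementary {𝒳 Ω : Type*} [MeasurableSpace 𝒳] {mΩ : MeasurableSpace Ω}
    (p : Measure 𝒳) (𝓕 : Filtration ℝ mΩ) (d : ℕ) where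
  a : ℝ
  b : ℝ
  a_le_b : a ≤ b
  A : Set (𝒳 × (Fin d → ℝ))
  isBounded_A : IsBounded (p.prod volume) A
  Y : Ω → ℝ
  measurable_Y : Measurable[𝓕 a] Y
  bounded_Y : ∃ C : ℝ, ∀ ω, |Y ω| ≤ C

section Integral

variable {𝒳 Ω : Type*} [MeasurableSpace 𝒳] {mΩ : MeasurableSpace Ω} {p : Measure 𝒳}
  {𝓕 : Filtration ℝ mΩ} {d : ℕ}

/-- The elementary integrand as a function on `(𝒳 × ℝ^(d+1)) × Ω`. -/
def Elementary.toFun (e : Elementary p 𝓕 d) (z : 𝒳 × SpaceTime d) (ω : Ω) : ℝ :=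
  (slab e.a e.b e.A).indicator (fun _ => e.Y ω) z

/-- A simple integrand is a finite sum of elementary ones. -/
def simpleFun (l : List (Elementary p 𝓕 d)) (z : 𝒳 × SpaceTime d) (ω : Ω) : ℝ :=
  (l.map fun e => e.toFun z ω).sum

/-- The integral `∑ Y W((a, b] × A)` of a simple integrand. -/
def simpleIntegral (W : Set (𝒳 × SpaceTime d) → Ω → ℝ) (l : List (Elementary p 𝓕 d)) (ω : Ω) : ℝ :=
  (l.map fun e => e.Y ω * W (slab e.a e.b e.A) ω).sum

/-- `I = ∫ φ(x, s) W(dx, ds)` in the sense of Walsh: `φ` is the limit in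
`L²((𝒳 × ℝ^(d+1)) × Ω)` of a sequence of simple integrands, whose integrals converge to `I`
in `L²(Ω)`. -/
def IsWalshIntegral (p : Measure 𝒳) (P : Measure Ω) (𝓕 : Filtration ℝ mΩ)
    (W : Set (𝒳 × SpaceTime d) → Ω → ℝ) (φ : 𝒳 × SpaceTime d → Ω → ℝ) (I : Ω → ℝ) : Prop :=
  MemLp I 2 P ∧ ∃ l : ℕ → List (Elementary p 𝓕 d),
    Tendsto (fun n => eLpNorm (fun q : (𝒳 × SpaceTime d) × Ω => φ q.1 q.2 - simpleFun (l n) q.1 q.2)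
      2 ((control p d).prod P)) atTop (𝓝 0) ∧
    Tendsto (fun n => eLpNorm (fun ω => I ω - simpleIntegral W (l n) ω) 2 P) atTop (𝓝 0)

/-- `X` is (a version of) the field `X(t) = ∫ g(x, t - s) σ(s) W(dx, ds)`. -/
def IsVMMMA (p : Measure 𝒳) (P : Measure Ω) (𝓕 : Filtration ℝ mΩ)
    (W : Set (𝒳 × SpaceTime d) → Ω → ℝ) (g : 𝒳 → SpaceTime d → ℝ) (σ : SpaceTime d → Ω → ℝ)
    (X : SpaceTime d → Ω → ℝ) : Prop :=
  ∀ t, IsWalshIntegral p P 𝓕 W (fun z ω => g z.1 (t - z.2) * σ z.2 ω) (X t)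

end Integral

/-- The finite-dimensional distributions are invariant under translation. -/
def IsStrictlyStationary {T Ω : Type*} [Add T] [MeasurableSpace Ω] (P : Measure Ω)
    (X : T → Ω → ℝ) : Prop :=
  ∀ (n : ℕ) (t : Fin n → T) (h : T),
    IdentDistrib (fun ω i => X (t i + h) ω) (fun ω i => X (t i) ω) P P

/-- Finite second moments, and mean and covariance function invariant under translation. -/
structure IsSecondOrderStationary {T Ω : Type*} [Add T] [MeasurableSpace Ω] (P : Measure Ω)
    (X : T → Ω → ℝ) : Prop where
  memLp : ∀ t, MemLp (X t) 2 P
  mean : ∀ t h, ∫ ω, X (t + h) ω ∂P = ∫ ω, X t ω ∂P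
  cov : ∀ t u h, covariance (X (t + h)) (X (u + h)) P = covariance (X t) (X u) P

end VMMMA

end

/-! The Itô isometry `eLpNorm_simpleIntegral` turns L² approximation of an integrand into L²
convergence of the integrals. Existence and uniqueness therefore reduce to approximating
g(x,t-s)σ(s) by simple integrands, which is `isAdmissible_mul`. The key is that a jointly
measurable, stationary, square integrable field is automatically mean square continuous, with a
modulus independent of the point (`IsStrictlyStationary.tendsto_lintegral_sub_sq`). On a fine grid σ
may thus be replaced, in each cell, by its value at the lower corner, which is known when the cell
begins. A Dynkin argument, truncations and simple functions lead from cells to a general kernel.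

The approximation gives more: its coefficients are measurable for the σ-algebra 𝓖 generated by the
field σ, as well as adapted. Since 𝓖 is independent of W, freezing the coefficients leaves a
Gaussian variable, and in the limit E exp(iI) = E exp(-½ ∫ φ² dc) for the integral I of φ
(`IsWalshIntegralOf.integral_exp`).

Applied to ∑ rᵢ X(tᵢ), this gives E exp(-½ ∫ H²σ² dc) with H(x,s) = ∑ rᵢ g(x,tᵢ-s). Translating all
tᵢ translates H, and invariance of c moves the translation onto σ. The integral involves uncountably
many values of σ, yet its Laplace transform depends only on the finite-dimensional distributions:
after truncation its moments are, by Fubini, integrals of k-point expectations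
(`integral_exp_neg_integral_sq_eq`). Linear combinations determine joint laws, whence strict
stationarity; with X(t) in L², second-order stationarity follows. -/

namespace VMMMA

/-! ### Gaussian random measures: covariance and joint characteristic functions. -/

section Basis

variable {E Ω : Type*} [MeasurableSpace E] [MeasurableSpace Ω] {c : Measure E} {P : Measure Ω} {W : Set E → Ω → ℝ}

lemma isBounded_empty : IsBounded c ∅ := ⟨.empty, by simp⟩

lemma IsBounded.mono {A B : Set E} (hB : IsBounded c B) (hA : MeasurableSet A) (h : A ⊆ B) :
    IsBounded c A := ⟨hA, (measure_mono h).trans_lt hB.2⟩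

lemma IsBounded.union {A B : Set E} (hA : IsBounded c A) (hB : IsBounded c B) :
    IsBounded c (A ∪ B) := ⟨hA.1.union hB.1, measure_union_lt_top hA.2 hB.2⟩

lemma IsBounded.inter {A B : Set E} (hA : IsBounded c A) (hB : IsBounded c B) :
    IsBounded c (A ∩ B) := hA.mono (hA.1.inter hB.1) Set.inter_subset_left

lemma IsBounded.diff {A B : Set E} (hA : IsBounded c A) (hB : IsBounded c B) :
    IsBounded c (A \ B) := hA.mono (hA.1.diff hB.1) Set.sdiff_subset

namespace IsGaussianBasis

lemma hasLaw (hW : IsGaussianBasis c P W) {A : Set E} (hA : IsBounded c A) :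
    HasLaw (W A) (gaussianReal 0 (c A).toNNReal) P :=
  ⟨(hW.measurable A hA).aemeasurable, hW.law A hA⟩

lemma memLp (hW : IsGaussianBasis c P W) {A : Set E} (hA : IsBounded c A) :
    MemLp (W A) 2 P := by
  have h := memLp_id_gaussianReal (μ := 0) (v := (c A).toNNReal) 2
  rw [← hW.law A hA] at h
  exact (memLp_map_measure_iff aestronglyMeasurable_id
    (hW.measurable A hA).aemeasurable).1 h

/-- Independence over disjoint sets indexed by an arbitrary encodable type. -/
lemma iIndepFun_of_encodable (hW : IsGaussianBasis c P W) {ι : Type*} [Encodable ι]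
    {A : ι → Set E} (hA : ∀ i, IsBounded c (A i)) (hd : Pairwise (Function.onFun Disjoint A)) :
    iIndepFun (fun i => W (A i)) P := by
  -- Codes of no element are sent to ∅. `decode₂` succeeds only on genuine codes, so distinct
  -- indices never carry the same set twice.
  let B : ℕ → Set E := fun n => (Encodable.decode₂ ι n).elim ∅ A
  have hB : ∀ n, IsBounded c (B n) := by
    intro n
    rcases h : Encodable.decode₂ ι n with _ | i
    · simpa [B, h] using isBounded_empty
    · simpa [B, h] using hA i
  have hBd : Pairwise (Function.onFun Disjoint B) := by
    intro m n hmn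
    rcases hm : Encodable.decode₂ ι m with _ | i
    · simp [Function.onFun, B, hm]
    rcases hn : Encodable.decode₂ ι n with _ | j
    · simp [Function.onFun, B, hn]
    have hij : i ≠ j := by
      rintro rfl
      exact hmn (by rw [← Encodable.decode₂_eq_some.1 hm, ← Encodable.decode₂_eq_some.1 hn])
    simpa [Function.onFun, B, hm, hn] using hd hij
  have h := (hW.indep B hB hBd).precomp (g := Encodable.encode (α := ι)) Encodable.encode_injective
  simpa [B, Encodable.encodek₂] using h

lemma integral_eq_zero (hW : IsGaussianBasis c P W) {A : Set E} (hA : IsBounded c A) :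
    ∫ ω, W A ω ∂P = 0 := by
  rw [(hW.hasLaw hA).integral_eq, integral_id_gaussianReal]

variable [IsProbabilityMeasure P] in
lemma integral_sq (hW : IsGaussianBasis c P W) {A : Set E} (hA : IsBounded c A) :
    ∫ ω, W A ω ^ 2 ∂P = c.real A := by
  have h := (hW.hasLaw hA).variance_eq
  rw [variance_id_gaussianReal, variance_eq_sub (hW.memLp hA), hW.integral_eq_zero hA] at h
  simpa [Measure.real, ENNReal.toReal] using h

-- The second moment is c(∅) = 0. This is needed before finite additivity, because additivity is
-- given for sequences and a finite family has to be padded with ∅.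
variable [IsProbabilityMeasure P] in
lemma empty (hW : IsGaussianBasis c P W) : W ∅ =ᵐ[P] 0 := by
  have h := hW.integral_sq isBounded_empty
  have h2 := (integral_eq_zero_iff_of_nonneg (fun _ => sq_nonneg _)
    (hW.memLp isBounded_empty).integrable_sq).1 (by simpa using h)
  filter_upwards [h2] with ω hω
  simpa using hω

lemma indepFun (hW : IsGaussianBasis c P W) {A B : Set E} (hA : IsBounded c A)
    (hB : IsBounded c B) (h : Disjoint A B) : IndepFun (W A) (W B) P := by
  have := hW.iIndepFun_of_encodable (A := fun b : Bool => cond b A B)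
    (by rintro (_ | _) <;> simpa) (by
      rintro (_ | _) (_ | _) hab <;> simp_all [Function.onFun, h.symm])
  simpa using this.indepFun (i := true) (j := false) (by simp)

variable [IsProbabilityMeasure P]

lemma union (hW : IsGaussianBasis c P W) {A B : Set E} (hA : IsBounded c A)
    (hB : IsBounded c B) (h : Disjoint A B) : W (A ∪ B) =ᵐ[P] W A + W B := by
  let S : ℕ → Set E := fun n => if n = 0 then A else if n = 1 then B else ∅
  have hU : ⋃ n, S n = A ∪ B := by
    ext x
    simp only [Set.mem_iUnion, Set.mem_union, S]
    constructor
    · rintro ⟨n, hn⟩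
      split_ifs at hn <;> simp_all
    · rintro (hx | hx)
      · exact ⟨0, by simpa⟩
      · exact ⟨1, by simpa⟩
  have key := hW.additive S (fun n => by
      simp only [S]; split_ifs <;> [exact hA; exact hB; exact isBounded_empty])
    (fun m n hmn => by
      simp only [S, Function.onFun]
      split_ifs <;> simp_all [h.symm]) (by rw [hU]; exact hA.union hB)
  filter_upwards [key, hW.empty] with ω h1 h2
  rw [hU] at h1
  refine tendsto_nhds_unique h1 (tendsto_const_nhds.congr' ?_)
  filter_upwards [eventually_ge_atTop 2] with n hn
  obtain ⟨m, rfl⟩ := Nat.exists_eq_add_of_le' hn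
  rw [Finset.sum_range_succ', Finset.sum_range_succ']
  simp [h2, S, add_comm]

/-- Split A and B along A ∩ B. Among the three disjoint pieces A ∩ B, A \ B and B \ A the mixed
products have mean zero, so only the square of W(A ∩ B) survives. -/
lemma integral_mul (hW : IsGaussianBasis c P W) {A B : Set E} (hA : IsBounded c A)
    (hB : IsBounded c B) : ∫ ω, W A ω * W B ω ∂P = c.real (A ∩ B) := by
  have hAB := hA.inter hB
  have h1 := hW.union hAB (hA.diff hB) disjoint_inf_sdiff
  have h2 := hW.union hAB (hB.diff hA) (by
    rw [Set.inter_comm]; exact disjoint_inf_sdiff)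
  rw [Set.inter_union_sdiff] at h1
  rw [Set.inter_comm, Set.inter_union_sdiff, Set.inter_comm] at h2
  have hz : ∀ {S T : Set E}, IsBounded c S → IsBounded c T → Disjoint S T →
      ∫ ω, W S ω * W T ω ∂P = 0 := fun hS hT hd => by
    have := (hW.indepFun hS hT hd).integral_fun_mul_eq_mul_integral
      (hW.memLp hS).aestronglyMeasurable (hW.memLp hT).aestronglyMeasurable
    rw [this, hW.integral_eq_zero hS, zero_mul]
  have hi : ∀ {S T : Set E}, IsBounded c S → IsBounded c T →
      Integrable (fun ω => W S ω * W T ω) P := fun hS hT =>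
    (hW.memLp hS).integrable_mul (hW.memLp hT)
  have hd := hA.diff hB
  have hd' := hB.diff hA
  calc ∫ ω, W A ω * W B ω ∂P
      = ∫ ω, ((W (A ∩ B) ω * W (A ∩ B) ω + W (A ∩ B) ω * W (B \ A) ω) +
          (W (A \ B) ω * W (A ∩ B) ω + W (A \ B) ω * W (B \ A) ω)) ∂P := by
        refine integral_congr_ae ?_
        filter_upwards [h1, h2] with ω e1 e2
        rw [e1, e2]; simp only [Pi.add_apply]; ring
    _ = c.real (A ∩ B) := by
        rw [integral_add (f := fun ω => W (A ∩ B) ω * W (A ∩ B) ω + W (A ∩ B) ω * W (B \ A) ω)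
            (g := fun ω => W (A \ B) ω * W (A ∩ B) ω + W (A \ B) ω * W (B \ A) ω)
            ((hi hAB hAB).add (hi hAB hd')) ((hi hd hAB).add (hi hd hd')),
          integral_add (hi hAB hAB) (hi hAB hd'), integral_add (hi hd hAB) (hi hd hd'),
          hz hAB hd' (disjoint_sdiff_self_right.mono_left Set.inter_subset_left),
          hz hd hAB (disjoint_sdiff_self_left.mono_right Set.inter_subset_right),
          hz hd hd' (disjoint_sdiff_self_left.mono_right Set.sdiff_subset)]
        simp_rw [← sq]
        simp [hW.integral_sq hAB]

end IsGaussianBasis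

lemma coeFn_sum_smul_toLp {ι : Type*} (s : Finset ι) (r : ι → ℝ) (f : ι → Ω → ℝ)
    (hf : ∀ i, MemLp (f i) 2 P) :
    (∑ i ∈ s, r i • (hf i).toLp : Lp ℝ 2 P) =ᵐ[P] fun ω => ∑ i ∈ s, r i * f i ω := by
  have h : (∑ i ∈ s, r i • (hf i).toLp : Lp ℝ 2 P) =
      (memLp_finsetSum s fun i _ => (hf i).const_mul (r i)).toLp
        (fun ω => ∑ i ∈ s, r i * f i ω) := by
    ext1
    refine (Lp.coeFn_fun_finsetSum s _).trans (Filter.EventuallyEq.trans ?_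
      (MemLp.coeFn_toLp _).symm)
    have : ∀ᵐ ω ∂P, ∀ i ∈ s, (r i • (hf i).toLp : Lp ℝ 2 P) ω = r i * f i ω := by
      rw [Filter.eventually_all_finset]
      intro i _
      filter_upwards [Lp.coeFn_smul (r i) (hf i).toLp, (hf i).coeFn_toLp] with ω h1 h2
      rw [h1, Pi.smul_apply, h2, smul_eq_mul]
    filter_upwards [this] with ω hω
    exact Finset.sum_congr rfl hω
  rw [h]
  exact MemLp.coeFn_toLp _

lemma simpleFunc_sum_apply {ι : Type*} (s : Finset ι) (F : ι → SimpleFunc E ℝ) (z : E) :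
    (∑ i ∈ s, F i : SimpleFunc E ℝ) z = ∑ i ∈ s, F i z := by
  classical
  induction s using Finset.induction_on with
  | empty => simp
  | insert i s hi ih => simp [Finset.sum_insert hi, ih]

variable [IsProbabilityMeasure P]

open SimpleFunc in
/-- A linear combination of values of `W` depends only on the corresponding step function. -/
lemma IsGaussianBasis.sum_ae_eq_sum_fiber (hW : IsGaussianBasis c P W) {ι : Type*} [Fintype ι]
    (S : ι → Set E) (hS : ∀ i, IsBounded c (S i)) (y : ι → ℝ) (f : SimpleFunc E ℝ)
    (hf : ∀ z, f z = ∑ i, (S i).indicator (fun _ => y i) z) :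
    Integrable f c ∧ (fun ω => ∑ i, y i * W (S i) ω) =ᵐ[P]
      fun ω => ∑ x ∈ f.range with x ≠ 0, x * W (f ⁻¹' {x}) ω := by
  classical
  -- Extending W by 0 puts every value in L², so that `T` below is defined on all sets.
  let V : Set E → Ω → ℝ := fun A => if IsBounded c A then W A else 0
  have hV : ∀ {A}, IsBounded c A → V A = W A := fun h => if_pos h
  have hVm : ∀ A, MemLp (V A) 2 P := fun A => by
    by_cases h : IsBounded c A
    · rw [hV h]; exact hW.memLp h
    · simp [V, h]
  -- A ↦ W(A) is a finitely additive L²-valued set function. The associated integral of a step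
  -- function does not depend on how the function is written as a combination of indicators, which
  -- is the claim.
  let T : Set E → ℝ →L[ℝ] Lp ℝ 2 P := fun A =>
    ContinuousLinearMap.toSpanSingleton ℝ ((hVm A).toLp)
  have hT : ∀ A (x : ℝ), T A x = x • (hVm A).toLp := fun A x => by
    simp [T]
  have hadd : FinMeasAdditive c T := by
    intro A B hA hB hA' hB' hd
    have hA : IsBounded c A := ⟨hA, hA'.lt_top⟩
    have hB : IsBounded c B := ⟨hB, hB'.lt_top⟩
    ext1
    rw [_root_.add_apply, hT, hT, hT, ← smul_add, ← MemLp.toLp_add]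
    congr 1
    refine MemLp.toLp_congr _ _ ?_
    rw [hV hA, hV hB, hV (hA.union hB)]
    exact hW.union hA hB hd
  let F : ι → SimpleFunc E ℝ := fun i =>
    piecewise (S i) (hS i).1 (SimpleFunc.const E (y i)) (SimpleFunc.const E 0)
  have hF : ∀ i z, F i z = (S i).indicator (fun _ => y i) z := fun i z => by
    simp [F, Set.indicator, Set.piecewise]
  have hFi : ∀ i, Integrable (F i) c := fun i => by
    have : (F i : E → ℝ) = (S i).indicator (fun _ => y i) := funext (hF i)
    rw [this, integrable_indicator_iff (hS i).1]
    exact integrableOn_const (hS i).2.ne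
  have hT0 : T ∅ = 0 := by
    ext1
    rw [hT, MemLp.toLp_congr (hVm ∅) MemLp.zero (by rw [hV isBounded_empty]; exact hW.empty)]
    simp
  have hsum : ∀ s : Finset ι, Integrable (∑ i ∈ s, F i : SimpleFunc E ℝ) c ∧
      setToSimpleFunc T (∑ i ∈ s, F i) = ∑ i ∈ s, T (S i) (y i) := by
    intro s
    induction s using Finset.induction_on with
    | empty => exact ⟨by simp, by
        rw [Finset.sum_empty, Finset.sum_empty]; exact setToSimpleFunc_zero_apply T⟩
    | insert i s hi ih =>
      rw [Finset.sum_insert hi, Finset.sum_insert hi, setToSimpleFunc_add T hadd (hFi i) ih.1, ih.2]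
      refine ⟨(hFi i).add ih.1, ?_⟩
      congr 1
      exact setToSimpleFunc_indicator T hT0 _ _
  obtain ⟨hfi, hfT⟩ := hsum Finset.univ
  have hff : ∑ i, F i = f := by
    ext z
    rw [hf, simpleFunc_sum_apply]; simp [hF]
  rw [hff] at hfi hfT
  refine ⟨hfi, ?_⟩
  rw [setToSimpleFunc_eq_sum_filter] at hfT
  simp_rw [hT] at hfT
  have h1 := coeFn_sum_smul_toLp (f.range.filter (· ≠ 0)) id (fun x => V (f ⁻¹' {x}))
    (fun x => hVm _)
  have h2 := coeFn_sum_smul_toLp Finset.univ y (fun i => V (S i)) (fun i => hVm _)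
  simp only [id] at h1
  rw [hfT] at h1
  filter_upwards [h1, h2] with ω e1 e2
  rw [e1] at e2
  convert! e2.symm using 1
  · exact Finset.sum_congr rfl fun i _ => by rw [hV (hS i)]
  · refine Finset.sum_congr rfl fun x hx => ?_
    rw [hV ⟨f.measurableSet_fiber x, measure_preimage_lt_top_of_integrable f hfi (by simp_all)⟩]

/-- The law of a finite linear combination of values of `W`, as a characteristic function. -/
lemma IsGaussianBasis.integral_exp_sum (hW : IsGaussianBasis c P W)
    {ι : Type*} [Fintype ι] (S : ι → Set E)
    (hS : ∀ i, IsBounded c (S i)) (y : ι → ℝ) :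
    ∫ ω, Complex.exp (((∑ i, y i * W (S i) ω : ℝ) : ℂ) * Complex.I) ∂P =
      (Real.exp (-(∫ z, (∑ i, (S i).indicator (fun _ => y i) z) ^ 2 ∂c) / 2) : ℝ) := by
  classical
  let f : SimpleFunc E ℝ := ∑ i,
    SimpleFunc.piecewise (S i) (hS i).1 (SimpleFunc.const E (y i)) (SimpleFunc.const E 0)
  have hfz : ∀ z, f z = ∑ i, (S i).indicator (fun _ => y i) z := fun z => by
    simp only [f]
    rw [simpleFunc_sum_apply]
    simp [Set.indicator, Set.piecewise]
  obtain ⟨hfi, hae⟩ := hW.sum_ae_eq_sum_fiber S hS y f hfz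
  set s : Finset ℝ := {x ∈ f.range | x ≠ 0} with hs
  have hb : ∀ x ∈ s, IsBounded c (f ⁻¹' {x}) := fun x hx =>
    ⟨f.measurableSet_fiber x,
      SimpleFunc.measure_preimage_lt_top_of_integrable f hfi (by simp_all)⟩
  -- The sets `S i` may overlap, but the nonzero level sets of `f` are disjoint; over them the
  -- characteristic function factors.
  have hind : iIndepFun (s.restrict fun x ω => x * W (f ⁻¹' {x}) ω) P := by
    have := Encodable.ofCountable s
    refine (hW.iIndepFun_of_encodable (A := fun x : s => f ⁻¹' {x.1}) (fun x => hb _ x.2)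
      fun x x' hx => ?_).comp (fun x w => x.1 * w) (fun x => by fun_prop)
    exact Disjoint.preimage _ (by
      rw [Set.disjoint_singleton]; exact fun h => hx (Subtype.ext h))
  have hchar := congrFun (hind.charFun_map_fun_finsetSum_eq_prod
    (fun x hx => ((hW.measurable _ (hb x hx)).const_mul x).aemeasurable)) 1
  rw [charFun_apply_real, integral_map (by
    refine Finset.aemeasurable_fun_sum _ fun x hx =>
      ((hW.measurable _ (hb x hx)).const_mul x).aemeasurable) (by fun_prop)] at hchar
  have hint : ∫ z, (∑ i, (S i).indicator (fun _ => y i) z) ^ 2 ∂c =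
      ∑ x ∈ s, x ^ 2 * c.real (f ⁻¹' {x}) := by
    have h1 := SimpleFunc.map_integral f (· ^ 2 : ℝ → ℝ) hfi (by simp)
    rw [SimpleFunc.integral_eq_integral] at h1
    · simp only [SimpleFunc.coe_map, Function.comp_apply, hfz, smul_eq_mul] at h1
      rw [h1, hs, Finset.sum_filter_of_ne]
      · simp [mul_comm]
      · rintro x - h rfl; simp at h
    · exact SimpleFunc.integrable_iff_finMeasSupp.2
        ((SimpleFunc.integrable_iff_finMeasSupp.1 hfi).map (by simp))
  calc _ = ∏ x ∈ s, charFun (P.map fun ω => x * W (f ⁻¹' {x}) ω) 1 := by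
        rw [Finset.prod_apply] at hchar
        rw [← hchar]
        refine integral_congr_ae ?_
        filter_upwards [hae] with ω hω
        rw [hω]; simp
    _ = ∏ x ∈ s, Complex.exp (-(x ^ 2 * c.real (f ⁻¹' {x}) / 2 : ℝ)) := by
        refine Finset.prod_congr rfl fun x hx => ?_
        have := charFun_map_smul_comp (hW.measurable _ (hb x hx)).aemeasurable x (1 : ℝ) (μ := P)
        simp only [smul_eq_mul, mul_one] at this
        rw [this, hW.law _ (hb x hx), charFun_gaussianReal]
        congr 1
        simp [Measure.real, ENNReal.toReal]
        ring
    _ = _ := by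
        rw [hint, ← Complex.exp_sum, Complex.ofReal_exp]
        congr 1
        push_cast
        rw [Finset.sum_neg_distrib, neg_div, Finset.sum_div]

end Basis

/-! ### Simple integrands and the Itô isometry. -/

section Simple

variable {𝒳 Ω : Type*} [MeasurableSpace 𝒳] {mΩ : MeasurableSpace Ω} {p : Measure 𝒳}
  {P : Measure Ω} {𝓕 : Filtration ℝ mΩ} {d : ℕ}

lemma measurableSet_slab (a b : ℝ) {A : Set (𝒳 × (Fin d → ℝ))} (hA : MeasurableSet A) :
    MeasurableSet (slab a b A) := by
  have h : Measurable fun z : 𝒳 × SpaceTime d => (z.1, Fin.tail z.2) :=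
    measurable_fst.prodMk (measurable_pi_lambda _ fun i =>
      (measurable_pi_apply i.succ).comp measurable_snd)
  have h0 : Measurable fun z : 𝒳 × SpaceTime d => z.2 0 :=
    (measurable_pi_apply 0).comp measurable_snd
  exact (h0 measurableSet_Ioc).inter (h hA)

lemma control_slab [SFinite p] (a b : ℝ) {A : Set (𝒳 × (Fin d → ℝ))} (hA : MeasurableSet A) :
    control p d (slab a b A) = ENNReal.ofReal (b - a) * p.prod volume A := by
  rw [control, Measure.prod_apply (measurableSet_slab a b hA), Measure.prod_apply hA,
    ← lintegral_const_mul _ (measurable_measure_prodMk_left hA)]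
  refine lintegral_congr fun x => ?_
  have h := (volume_preserving_piFinSuccAbove (fun _ : Fin (d + 1) => ℝ) 0).measure_preimage
    (measurableSet_Ioc.prod (measurable_prodMk_left hA : MeasurableSet (Prod.mk x ⁻¹' A))
      : MeasurableSet (Set.Ioc a b ×ˢ (Prod.mk x ⁻¹' A))).nullMeasurableSet
  rw [Measure.volume_eq_prod, Measure.prod_prod, Real.volume_Ioc] at h
  exact h

namespace Elementary

/-- The set of points where an elementary integrand may be nonzero. -/
def support (e : Elementary p 𝓕 d) : Set (𝒳 × SpaceTime d) := slab e.a e.b e.A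

lemma measurable_coeff (e : Elementary p 𝓕 d) : Measurable e.Y :=
  e.measurable_Y.mono (𝓕.le _) le_rfl

lemma toFun_eq (e : Elementary p 𝓕 d) (z : 𝒳 × SpaceTime d) (ω : Ω) :
    e.toFun z ω = e.support.indicator 1 z * e.Y ω := by
  by_cases h : z ∈ slab e.a e.b e.A <;> simp [toFun, support, h]

lemma memLp_coeff (e : Elementary p 𝓕 d) (r : ℝ≥0∞) [IsProbabilityMeasure P] :
    MemLp e.Y r P := by
  obtain ⟨C, hC⟩ := e.bounded_Y
  exact MemLp.of_bound e.measurable_coeff.aestronglyMeasurable C (ae_of_all _ hC)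

end Elementary

lemma simpleFun_cons (e : Elementary p 𝓕 d) (l : List (Elementary p 𝓕 d)) (z : 𝒳 × SpaceTime d)
    (ω : Ω) : simpleFun (e :: l) z ω = e.toFun z ω + simpleFun l z ω := by
  simp [simpleFun]

lemma simpleIntegral_cons (W : Set (𝒳 × SpaceTime d) → Ω → ℝ) (e : Elementary p 𝓕 d)
    (l : List (Elementary p 𝓕 d)) (ω : Ω) :
    simpleIntegral W (e :: l) ω = e.Y ω * W e.support ω + simpleIntegral W l ω := by
  simp [simpleIntegral, Elementary.support]

lemma simpleFun_append (l l' : List (Elementary p 𝓕 d)) (z : 𝒳 × SpaceTime d) (ω : Ω) :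
    simpleFun (l ++ l') z ω = simpleFun l z ω + simpleFun l' z ω := by
  simp [simpleFun]

lemma simpleIntegral_append (W : Set (𝒳 × SpaceTime d) → Ω → ℝ) (l l' : List (Elementary p 𝓕 d))
    (ω : Ω) : simpleIntegral W (l ++ l') ω = simpleIntegral W l ω + simpleIntegral W l' ω := by
  simp [simpleIntegral]

/-- Multiplication of an elementary integrand by a constant. -/
def Elementary.smul (r : ℝ) (e : Elementary p 𝓕 d) : Elementary p 𝓕 d where
  a := e.a
  b := e.b
  a_le_b := e.a_le_b
  A := e.A
  isBounded_A := e.isBounded_A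
  Y := fun ω => r * e.Y ω
  measurable_Y := e.measurable_Y.const_mul r
  bounded_Y := by
    obtain ⟨C, hC⟩ := e.bounded_Y
    exact ⟨|r| * C, fun ω => by rw [abs_mul]; gcongr; exact hC ω⟩

lemma simpleFun_smul (r : ℝ) (l : List (Elementary p 𝓕 d)) (z : 𝒳 × SpaceTime d) (ω : Ω) :
    simpleFun (l.map (Elementary.smul r)) z ω = r * simpleFun l z ω := by
  induction l with
  | nil => simp [simpleFun]
  | cons e l ih =>
    rw [List.map_cons, simpleFun_cons, simpleFun_cons, ih, mul_add, Elementary.toFun_eq,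
      Elementary.toFun_eq]
    simp only [Elementary.smul, Elementary.support]
    ring

lemma simpleIntegral_smul (W : Set (𝒳 × SpaceTime d) → Ω → ℝ) (r : ℝ)
    (l : List (Elementary p 𝓕 d)) (ω : Ω) :
    simpleIntegral W (l.map (Elementary.smul r)) ω = r * simpleIntegral W l ω := by
  induction l with
  | nil => simp [simpleIntegral]
  | cons e l ih =>
    rw [List.map_cons, simpleIntegral_cons, simpleIntegral_cons, ih, mul_add]
    simp only [Elementary.smul, Elementary.support]
    ring

/-- Independence of past and future in the form used for the isometry, where the future factor is
either one value of W or a product of two. -/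
lemma IsNoiseFiltration.integral_mul {W : Set (𝒳 × SpaceTime d) → Ω → ℝ}
    (h : IsNoiseFiltration p P W 𝓕) {t : ℝ} {Z V : Ω → ℝ} (hZ : Measurable[𝓕 t] Z)
    (hV : Measurable[⨆ A ∈ {A : Set (𝒳 × SpaceTime d) | IsBounded (control p d) A ∧
      A ⊆ {z | t < z.2 0}}, MeasurableSpace.comap (W A) inferInstance] V) (hVm : Measurable V) :
    ∫ ω, Z ω * V ω ∂P = (∫ ω, Z ω ∂P) * ∫ ω, V ω ∂P := by
  have hi : IndepFun Z V P := by
    rw [IndepFun_iff_Indep]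
    exact indep_of_indep_of_le_left (indep_of_indep_of_le_right (h.indep t) hV.comap_le) hZ.comap_le
  exact hi.integral_fun_mul_eq_mul_integral (hZ.mono (𝓕.le t) le_rfl).aestronglyMeasurable
    hVm.aestronglyMeasurable

lemma measurable_future {W : Set (𝒳 × SpaceTime d) → Ω → ℝ} {t : ℝ} {A : Set (𝒳 × SpaceTime d)}
    (hA : IsBounded (control p d) A) (hAt : A ⊆ {z | t < z.2 0}) :
    Measurable[⨆ A ∈ {A : Set (𝒳 × SpaceTime d) | IsBounded (control p d) A ∧
      A ⊆ {z | t < z.2 0}}, MeasurableSpace.comap (W A) inferInstance] (W A) := by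
  rw [measurable_iff_comap_le]
  exact le_iSup₂_of_le A ⟨hA, hAt⟩ le_rfl

instance [SFinite p] : SFinite (control p d) := by unfold control; infer_instance

instance [SigmaFinite p] : SigmaFinite (control p d) := by unfold control; infer_instance

variable [IsProbabilityMeasure p] [IsProbabilityMeasure P]

lemma isBounded_slab (a b : ℝ) {A : Set (𝒳 × (Fin d → ℝ))}
    (hA : IsBounded (p.prod volume) A) : IsBounded (control p d) (slab a b A) :=
  ⟨measurableSet_slab a b hA.1, by
    rw [control_slab a b hA.1]; exact ENNReal.mul_lt_top ENNReal.ofReal_lt_top hA.2⟩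

namespace Elementary

lemma isBounded_support (e : Elementary p 𝓕 d) : IsBounded (control p d) e.support :=
  isBounded_slab _ _ e.isBounded_A

lemma measurable_toFun (e : Elementary p 𝓕 d) :
    Measurable fun q : (𝒳 × SpaceTime d) × Ω => e.toFun q.1 q.2 := by
  simp_rw [toFun_eq]
  exact ((measurable_one.indicator e.isBounded_support.1).comp measurable_fst).mul
    (e.measurable_coeff.comp measurable_snd)

lemma memLp_toFun (e : Elementary p 𝓕 d) :
    MemLp (fun q : (𝒳 × SpaceTime d) × Ω => e.toFun q.1 q.2) 2 ((control p d).prod P) := by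
  simp_rw [toFun_eq]
  have h := e.isBounded_support
  have hm : AEStronglyMeasurable (fun q : (𝒳 × SpaceTime d) × Ω =>
      e.support.indicator 1 q.1 * e.Y q.2) ((control p d).prod P) := by
    simpa only [toFun_eq] using e.measurable_toFun.aestronglyMeasurable
  rw [memLp_two_iff_integrable_sq hm]
  simp_rw [mul_pow]
  exact ((memLp_indicator_const 2 h.1 (1 : ℝ) (Or.inr h.2.ne)).integrable_sq).mul_prod
    (e.memLp_coeff 2).integrable_sq

lemma memLp_mul (e : Elementary p 𝓕 d) {W : Set (𝒳 × SpaceTime d) → Ω → ℝ}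
    (hW : IsGaussianBasis (control p d) P W) : MemLp (fun ω => e.Y ω * W e.support ω) 2 P := 
  (hW.memLp e.isBounded_support).mul (e.memLp_coeff ⊤)

end Elementary

/-- Itô isometry for two elementary integrands, the first of which starts earlier. -/
lemma integral_mul_elementary_of_le {W : Set (𝒳 × SpaceTime d) → Ω → ℝ}
    (hW : IsGaussianBasis (control p d) P W) (h𝓕 : IsNoiseFiltration p P W 𝓕)
    (e e' : Elementary p 𝓕 d) (h : e.a ≤ e'.a) :
    ∫ ω, (e.Y ω * W e.support ω) * (e'.Y ω * W e'.support ω) ∂P =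
      (control p d).real (e.support ∩ e'.support) * ∫ ω, e.Y ω * e'.Y ω ∂P := by
  set S := e.support
  set S' := e'.support
  have hS : IsBounded (control p d) S := e.isBounded_support
  have hS' : IsBounded (control p d) S' := e'.isBounded_support
  have hm : MeasurableSet {z : 𝒳 × SpaceTime d | z.2 0 ≤ e'.a} :=
    measurableSet_le ((measurable_pi_apply 0).comp measurable_snd) measurable_const
  -- Cut the earlier support at the starting time of the later integrand: `S₁` is past at that time,
  -- while `S₂` and `S'` are both future.
  set S₁ := S ∩ {z | z.2 0 ≤ e'.a}
  set S₂ := S \ {z | z.2 0 ≤ e'.a}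
  have hS₁ : IsBounded (control p d) S₁ := hS.mono (hS.1.inter hm) Set.inter_subset_left
  have hS₂ : IsBounded (control p d) S₂ := hS.mono (hS.1.diff hm) Set.sdiff_subset
  have hS₂t : S₂ ⊆ {z | e'.a < z.2 0} := fun z hz => by simpa using hz.2
  have hS't : S' ⊆ {z | e'.a < z.2 0} := fun z hz => hz.1.1
  have hsplit := hW.union hS₁ hS₂ (Set.disjoint_sdiff_right.mono_left Set.inter_subset_right)
  rw [show S₁ ∪ S₂ = S from Set.inter_union_sdiff _ _] at hsplit
  have hinter : S₂ ∩ S' = S ∩ S' := by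
    ext z
    refine ⟨fun hz => ⟨hz.1.1, hz.2⟩, fun hz => ⟨⟨hz.1, ?_⟩, hz.2⟩⟩
    simpa using hS't hz.2
  have hY := e.measurable_Y.mono (𝓕.mono h) le_rfl
  have hYY : Measurable[𝓕 e'.a] fun ω => e.Y ω * e'.Y ω := hY.mul e'.measurable_Y
  -- Everything except W(S') is known at time `e'.a`, and W(S') is centred.
  have e1 : ∫ ω, (e.Y ω * e'.Y ω * W S₁ ω) * W S' ω ∂P = 0 := by
    rw [h𝓕.integral_mul (Z := fun ω => e.Y ω * e'.Y ω * W S₁ ω)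
      (hYY.mul (h𝓕.adapted e'.a S₁ hS₁ Set.inter_subset_right))
      (measurable_future hS' hS't) (hW.measurable _ hS'), hW.integral_eq_zero hS', mul_zero]
  -- Both noise factors lie in the future, so the coefficients split off and the covariance of W
  -- remains.
  have e2 : ∫ ω, (e.Y ω * e'.Y ω) * (W S₂ ω * W S' ω) ∂P =
      (∫ ω, e.Y ω * e'.Y ω ∂P) * (control p d).real (S ∩ S') := by
    rw [h𝓕.integral_mul (V := fun ω => W S₂ ω * W S' ω) hYY
      ((measurable_future hS₂ hS₂t).mul (measurable_future hS' hS't))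
      ((hW.measurable _ hS₂).mul (hW.measurable _ hS')), hW.integral_mul hS₂ hS', hinter]
  have hbd : MemLp (fun ω => e.Y ω * e'.Y ω) ⊤ P :=
    (e'.memLp_coeff ⊤).mul (r := ⊤) (e.memLp_coeff ⊤)
  have i1 : Integrable (fun ω => (e.Y ω * e'.Y ω * W S₁ ω) * W S' ω) P := by
    have : MemLp (fun ω => e.Y ω * e'.Y ω * W S₁ ω) 2 P := (hW.memLp hS₁).mul hbd
    exact this.integrable_mul (hW.memLp hS')
  have i2 : Integrable (fun ω => (e.Y ω * e'.Y ω) * (W S₂ ω * W S' ω)) P := by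
    have : MemLp (fun ω => e.Y ω * e'.Y ω * W S₂ ω) 2 P := (hW.memLp hS₂).mul hbd
    exact (this.integrable_mul (hW.memLp hS')).congr
      (ae_of_all _ fun ω => mul_assoc (e.Y ω * e'.Y ω) (W S₂ ω) (W S' ω))
  calc _ = ∫ ω, ((e.Y ω * e'.Y ω * W S₁ ω) * W S' ω +
        (e.Y ω * e'.Y ω) * (W S₂ ω * W S' ω)) ∂P := by
        refine integral_congr_ae ?_
        filter_upwards [hsplit] with ω hω
        rw [hω, Pi.add_apply]; ring
    _ = _ := by rw [integral_add i1 i2, e1, e2, zero_add, mul_comm]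

lemma integral_mul_elementary {W : Set (𝒳 × SpaceTime d) → Ω → ℝ}
    (hW : IsGaussianBasis (control p d) P W) (h𝓕 : IsNoiseFiltration p P W 𝓕)
    (e e' : Elementary p 𝓕 d) :
    ∫ ω, (e.Y ω * W e.support ω) * (e'.Y ω * W e'.support ω) ∂P =
      ∫ q, e.toFun q.1 q.2 * e'.toFun q.1 q.2 ∂((control p d).prod P) := by
  have hR : ∫ q, e.toFun q.1 q.2 * e'.toFun q.1 q.2 ∂((control p d).prod P) =
      (control p d).real (e.support ∩ e'.support) * ∫ ω, e.Y ω * e'.Y ω ∂P := by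
    rw [← integral_indicator_one (e.isBounded_support.1.inter e'.isBounded_support.1),
      ← integral_prod_mul]
    refine integral_congr_ae (ae_of_all _ fun q => ?_)
    simp only [Elementary.toFun_eq, Set.inter_indicator_one, Pi.mul_apply]
    ring
  rw [hR]
  rcases le_total e.a e'.a with h | h
  · exact integral_mul_elementary_of_le hW h𝓕 e e' h
  · rw [Set.inter_comm, ← (integral_congr_ae (ae_of_all _ fun ω => mul_comm (e'.Y ω) (e.Y ω)) :
      ∫ ω, e'.Y ω * e.Y ω ∂P = _), ← integral_mul_elementary_of_le hW h𝓕 e' e h]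
    exact integral_congr_ae (ae_of_all _ fun ω => mul_comm _ _)

lemma measurable_simpleFun (l : List (Elementary p 𝓕 d)) :
    Measurable fun q : (𝒳 × SpaceTime d) × Ω => simpleFun l q.1 q.2 := by
  induction l with
  | nil => simp [simpleFun]
  | cons e l ih => simpa only [simpleFun_cons] using! e.measurable_toFun.add ih

lemma memLp_simpleFun (l : List (Elementary p 𝓕 d)) :
    MemLp (fun q : (𝒳 × SpaceTime d) × Ω => simpleFun l q.1 q.2) 2 ((control p d).prod P) := by
  induction l with
  | nil => simp [simpleFun]
  | cons e l ih => simpa only [simpleFun_cons] using! e.memLp_toFun.add ih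

variable {W : Set (𝒳 × SpaceTime d) → Ω → ℝ}

lemma memLp_simpleIntegral (hW : IsGaussianBasis (control p d) P W)
    (l : List (Elementary p 𝓕 d)) : MemLp (simpleIntegral W l) 2 P := by
  induction l with
  | nil => exact MemLp.zero (ε := ℝ)
  | cons e l ih =>
    rw [show simpleIntegral W (e :: l) = _ from funext (simpleIntegral_cons W e l)]
    exact (e.memLp_mul hW).add ih

lemma integral_add_mul {α : Type*} {mα : MeasurableSpace α} {μ : Measure α} {f g h : α → ℝ}
    (hf : MemLp f 2 μ) (hg : MemLp g 2 μ) (hh : MemLp h 2 μ) :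
    ∫ x, (f x + g x) * h x ∂μ = ∫ x, f x * h x ∂μ + ∫ x, g x * h x ∂μ := by
  simp_rw [add_mul]
  exact integral_add (hf.integrable_mul hh) (hg.integrable_mul hh)

lemma integral_mul_simple (hW : IsGaussianBasis (control p d) P W)
    (h𝓕 : IsNoiseFiltration p P W 𝓕) (l l' : List (Elementary p 𝓕 d)) :
    ∫ ω, simpleIntegral W l ω * simpleIntegral W l' ω ∂P =
      ∫ q, simpleFun l q.1 q.2 * simpleFun l' q.1 q.2 ∂((control p d).prod P) := by
  induction l with
  | nil => simp [simpleFun, simpleIntegral]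
  | cons e l ih =>
    simp_rw [simpleFun_cons, simpleIntegral_cons]
    rw [integral_add_mul (e.memLp_mul hW) (memLp_simpleIntegral hW l) (memLp_simpleIntegral hW l'),
      integral_add_mul e.memLp_toFun (memLp_simpleFun l) (memLp_simpleFun l'), ih]
    congr 1
    clear ih
    -- `integral_add_mul` is additive in the first factor, so the factors are swapped before the
    -- induction on `l'`.
    simp_rw [mul_comm (_ * _) (simpleIntegral W l' _), mul_comm _ (simpleFun l' _ _)]
    induction l' with
    | nil => simp [simpleFun, simpleIntegral]
    | cons e' l' ih =>
      simp_rw [simpleFun_cons, simpleIntegral_cons]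
      rw [integral_add_mul (e'.memLp_mul hW) (memLp_simpleIntegral hW l') (e.memLp_mul hW),
        integral_add_mul e'.memLp_toFun (memLp_simpleFun l') e.memLp_toFun, ih,
        integral_mul_elementary hW h𝓕]

lemma eLpNorm_two_eq_of_integral_sq_eq {α β : Type*} {mα : MeasurableSpace α}
    {mβ : MeasurableSpace β} {μ : Measure α} {ν : Measure β} {f : α → ℝ} {g : β → ℝ}
    (hf : MemLp f 2 μ) (hg : MemLp g 2 ν) (h : ∫ x, f x ^ 2 ∂μ = ∫ x, g x ^ 2 ∂ν) :
    eLpNorm f 2 μ = eLpNorm g 2 ν := by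
  rw [hf.eLpNorm_eq_integral_rpow_norm (by simp) (by simp),
    hg.eLpNorm_eq_integral_rpow_norm (by simp) (by simp)]
  simp [h]

/-- The Itô isometry for simple integrands. -/
lemma eLpNorm_simpleIntegral (hW : IsGaussianBasis (control p d) P W)
    (h𝓕 : IsNoiseFiltration p P W 𝓕) (l : List (Elementary p 𝓕 d)) :
    eLpNorm (simpleIntegral W l) 2 P =
      eLpNorm (fun q : (𝒳 × SpaceTime d) × Ω => simpleFun l q.1 q.2) 2 ((control p d).prod P) := by
  refine eLpNorm_two_eq_of_integral_sq_eq (memLp_simpleIntegral hW l) (memLp_simpleFun l) ?_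
  simp_rw [sq]
  exact integral_mul_simple hW h𝓕 l l

/-- Appending the negated list represents the difference as a single simple integrand, to which the
isometry applies. -/
lemma eLpNorm_simpleIntegral_sub (hW : IsGaussianBasis (control p d) P W)
    (h𝓕 : IsNoiseFiltration p P W 𝓕) (l l' : List (Elementary p 𝓕 d)) :
    eLpNorm (fun ω => simpleIntegral W l ω - simpleIntegral W l' ω) 2 P =
      eLpNorm (fun q : (𝒳 × SpaceTime d) × Ω => simpleFun l q.1 q.2 - simpleFun l' q.1 q.2) 2
        ((control p d).prod P) := by
  have h := eLpNorm_simpleIntegral hW h𝓕 (l ++ l'.map (Elementary.smul (-1)))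
  have e1 : ∀ ω, simpleIntegral W (l ++ l'.map (Elementary.smul (-1))) ω =
      simpleIntegral W l ω - simpleIntegral W l' ω := fun ω => by
    rw [simpleIntegral_append, simpleIntegral_smul]; ring
  have e2 : ∀ z ω, simpleFun (l ++ l'.map (Elementary.smul (-1))) z ω =
      simpleFun l z ω - simpleFun l' z ω := fun z ω => by
    rw [simpleFun_append, simpleFun_smul]; ring
  simp_rw [e2] at h
  rw [← h]
  exact congrArg (eLpNorm · 2 P) (funext fun ω => (e1 ω).symm)

end Simple

/-! ### The Walsh integral: existence, uniqueness, linearity. -/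

section Walsh

variable {𝒳 Ω : Type*} [MeasurableSpace 𝒳] {𝓖 : MeasurableSpace Ω} {mΩ : MeasurableSpace Ω} {p : Measure 𝒳}
  {P : Measure Ω} {𝓕 : Filtration ℝ mΩ} {d : ℕ}
  {W : Set (𝒳 × SpaceTime d) → Ω → ℝ} {φ : 𝒳 × SpaceTime d → Ω → ℝ} {I I' : Ω → ℝ}

variable (𝓖) in
/-- `φ` is an `L²` limit of simple integrands with `𝓖`-measurable coefficients. -/
def IsApproximable (p : Measure 𝒳) (P : Measure Ω) (𝓕 : Filtration ℝ mΩ)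
    (φ : 𝒳 × SpaceTime d → Ω → ℝ) : Prop :=
  ∀ ε : ℝ≥0∞, ε ≠ 0 → ∃ l : List (Elementary p 𝓕 d), (∀ e ∈ l, Measurable[𝓖] e.Y) ∧
    eLpNorm (fun q : (𝒳 × SpaceTime d) × Ω => φ q.1 q.2 - simpleFun l q.1 q.2) 2
      ((control p d).prod P) ≤ ε

lemma IsApproximable.exists_seq (h : IsApproximable 𝓖 p P 𝓕 φ) :
    ∃ l : ℕ → List (Elementary p 𝓕 d), (∀ n, ∀ e ∈ l n, Measurable[𝓖] e.Y) ∧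
      Tendsto (fun n => eLpNorm (fun q : (𝒳 × SpaceTime d) × Ω =>
        φ q.1 q.2 - simpleFun (l n) q.1 q.2) 2 ((control p d).prod P)) atTop (𝓝 0) := by
  choose l hl hle using fun n : ℕ => h ((n : ℝ≥0∞)⁻¹) (by simp)
  exact ⟨l, hl, tendsto_of_tendsto_of_tendsto_of_le_of_le tendsto_const_nhds
    ENNReal.tendsto_inv_nat_nhds_zero (fun _ => zero_le) hle⟩

variable (𝓖) in
/-- A Walsh integral that is approximated by simple integrands with `𝓖`-measurable coefficients. -/
def IsWalshIntegralOf (p : Measure 𝒳) (P : Measure Ω) (𝓕 : Filtration ℝ mΩ)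
    (W : Set (𝒳 × SpaceTime d) → Ω → ℝ) (φ : 𝒳 × SpaceTime d → Ω → ℝ) (I : Ω → ℝ) : Prop :=
  MemLp I 2 P ∧ ∃ l : ℕ → List (Elementary p 𝓕 d), (∀ n, ∀ e ∈ l n, Measurable[𝓖] e.Y) ∧
    Tendsto (fun n => eLpNorm (fun q : (𝒳 × SpaceTime d) × Ω => φ q.1 q.2 - simpleFun (l n) q.1 q.2)
      2 ((control p d).prod P)) atTop (𝓝 0) ∧
    Tendsto (fun n => eLpNorm (fun ω => I ω - simpleIntegral W (l n) ω) 2 P) atTop (𝓝 0)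

lemma IsWalshIntegralOf.zero : IsWalshIntegralOf 𝓖 p P 𝓕 W 0 0 :=
  ⟨MemLp.zero, fun _ => [], by simp, by simp [simpleFun], by simp [simpleIntegral]⟩

variable [IsProbabilityMeasure p]

lemma aestronglyMeasurable_simpleFun (l : List (Elementary p 𝓕 d)) :
    AEStronglyMeasurable (fun q : (𝒳 × SpaceTime d) × Ω => simpleFun l q.1 q.2)
      ((control p d).prod P) := (measurable_simpleFun l).aestronglyMeasurable

lemma eLpNorm_simpleFun_sub_le
    (hφ : AEStronglyMeasurable (fun q : (𝒳 × SpaceTime d) × Ω => φ q.1 q.2) ((control p d).prod P))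
    (l l' : List (Elementary p 𝓕 d)) :
    eLpNorm (fun q : (𝒳 × SpaceTime d) × Ω => simpleFun l q.1 q.2 - simpleFun l' q.1 q.2) 2
        ((control p d).prod P) ≤
      eLpNorm (fun q : (𝒳 × SpaceTime d) × Ω => φ q.1 q.2 - simpleFun l q.1 q.2) 2
        ((control p d).prod P) +
      eLpNorm (fun q : (𝒳 × SpaceTime d) × Ω => φ q.1 q.2 - simpleFun l' q.1 q.2) 2
        ((control p d).prod P) := by
  have h := eLpNorm_sub_le (p := 2) (hφ.sub (aestronglyMeasurable_simpleFun (𝓕 := 𝓕) l'))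
    (hφ.sub (aestronglyMeasurable_simpleFun (𝓕 := 𝓕) l)) (by norm_num)
  refine le_trans (le_of_eq ?_) (h.trans_eq (add_comm _ _))
  congr 1
  ext q
  simp

variable [IsProbabilityMeasure P]

/-- The integrals of any approximating sequence converge to the Walsh integral. -/
lemma IsWalshIntegral.tendsto (hW : IsGaussianBasis (control p d) P W)
    (h𝓕 : IsNoiseFiltration p P W 𝓕)
    (hφ : AEStronglyMeasurable (fun q : (𝒳 × SpaceTime d) × Ω => φ q.1 q.2) ((control p d).prod P))
    (hI : IsWalshIntegral p P 𝓕 W φ I) {l : ℕ → List (Elementary p 𝓕 d)}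
    (hl : Tendsto (fun n => eLpNorm (fun q : (𝒳 × SpaceTime d) × Ω =>
      φ q.1 q.2 - simpleFun (l n) q.1 q.2) 2 ((control p d).prod P)) atTop (𝓝 0)) :
    Tendsto (fun n => eLpNorm (fun ω => I ω - simpleIntegral W (l n) ω) 2 P) atTop (𝓝 0) := by
  obtain ⟨hI2, k, hk, hkI⟩ := hI
  have hsum := hkI.add (hk.add hl)
  simp only [add_zero] at hsum
  refine tendsto_of_tendsto_of_tendsto_of_le_of_le tendsto_const_nhds hsum (fun _ => zero_le) ?_
  intro n
  have h1 := eLpNorm_add_le (p := 2)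
    (hI2.sub (memLp_simpleIntegral hW (k n))).aestronglyMeasurable
    ((memLp_simpleIntegral hW (k n)).sub (memLp_simpleIntegral hW (l n))).aestronglyMeasurable
    (by norm_num)
  calc eLpNorm (fun ω => I ω - simpleIntegral W (l n) ω) 2 P
      = eLpNorm (I - simpleIntegral W (k n) +
          (simpleIntegral W (k n) - simpleIntegral W (l n))) 2 P := by
        congr 1; ext ω; simp
    _ ≤ _ := h1
    _ ≤ _ := by
        refine add_le_add le_rfl ?_
        exact (eLpNorm_simpleIntegral_sub hW h𝓕 (k n) (l n)).trans_le
          (eLpNorm_simpleFun_sub_le hφ _ _)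

/-- The sequence that witnesses one integral also converges to the other, by
`IsWalshIntegral.tendsto`. -/
lemma IsWalshIntegral.ae_eq (hW : IsGaussianBasis (control p d) P W)
    (h𝓕 : IsNoiseFiltration p P W 𝓕)
    (hφ : AEStronglyMeasurable (fun q : (𝒳 × SpaceTime d) × Ω => φ q.1 q.2) ((control p d).prod P))
    (hI : IsWalshIntegral p P 𝓕 W φ I) (hI' : IsWalshIntegral p P 𝓕 W φ I') : I =ᵐ[P] I' := by
  obtain ⟨l, hl, hlI'⟩ := hI'.2
  have hlI := hI.tendsto hW h𝓕 hφ hl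
  have hsum := hlI.add hlI'
  simp only [add_zero] at hsum
  have h0 : eLpNorm (I - I') 2 P ≤ 0 := by
    refine ge_of_tendsto' hsum fun n => ?_
    have h := eLpNorm_sub_le (p := 2)
      (hI.1.sub (memLp_simpleIntegral hW (l n))).aestronglyMeasurable
      (hI'.1.sub (memLp_simpleIntegral hW (l n))).aestronglyMeasurable (by norm_num)
    refine le_trans (le_of_eq ?_) h
    congr 1; ext ω; simp
  have h1 := (eLpNorm_eq_zero_iff (hI.1.sub hI'.1).aestronglyMeasurable (by norm_num)).1
    (le_antisymm h0 zero_le)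
  filter_upwards [h1] with ω hω
  exact sub_eq_zero.1 hω

/-- By the isometry an approximating sequence has integrals that are Cauchy in L²; completeness
supplies the limit. -/
lemma exists_isWalshIntegral (hW : IsGaussianBasis (control p d) P W)
    (h𝓕 : IsNoiseFiltration p P W 𝓕)
    (hφ : AEStronglyMeasurable (fun q : (𝒳 × SpaceTime d) × Ω => φ q.1 q.2) ((control p d).prod P))
    (h : IsApproximable 𝓖 p P 𝓕 φ) : ∃ I, IsWalshIntegral p P 𝓕 W φ I := by
  obtain ⟨l, -, hl⟩ := h.exists_seq
  let J : ℕ → Lp ℝ 2 P := fun n => (memLp_simpleIntegral hW (l n)).toLp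
  have hJ : CauchySeq J := by
    rw [EMetric.cauchySeq_iff]
    intro ε hε
    have hε2 : (0 : ℝ≥0∞) < ε / 2 := ENNReal.half_pos hε.ne'
    obtain ⟨N, hN⟩ := eventually_atTop.1 (hl.eventually (gt_mem_nhds hε2))
    refine ⟨N, fun m hm n hn => ?_⟩
    rw [Lp.edist_toLp_toLp]
    calc _ = _ := eLpNorm_simpleIntegral_sub hW h𝓕 (l m) (l n)
      _ ≤ _ := eLpNorm_simpleFun_sub_le hφ _ _
      _ < ε / 2 + ε / 2 := ENNReal.add_lt_add (hN m hm) (hN n hn)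
      _ = ε := ENNReal.add_halves ε
  obtain ⟨I, hI⟩ := cauchySeq_tendsto_of_complete hJ
  refine ⟨I, Lp.memLp I, l, hl, ?_⟩
  have h2 := tendsto_iff_edist_tendsto_0.1 hI
  refine h2.congr fun n => ?_
  rw [edist_comm, Lp.edist_def]
  refine eLpNorm_congr_ae ?_
  filter_upwards [(memLp_simpleIntegral hW (l n)).coeFn_toLp] with ω hω
  simp only [Pi.sub_apply, J, hω]

/-- A given integral comes with coefficients that are merely adapted. Since any approximating
sequence yields it, one with 𝓖-measurable coefficients can be substituted; this is what permits
conditioning on 𝓖. -/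
lemma IsWalshIntegral.isWalshIntegralOf (hW : IsGaussianBasis (control p d) P W)
    (h𝓕 : IsNoiseFiltration p P W 𝓕)
    (hφ : AEStronglyMeasurable (fun q : (𝒳 × SpaceTime d) × Ω => φ q.1 q.2) ((control p d).prod P))
    (hI : IsWalshIntegral p P 𝓕 W φ I) (h : IsApproximable 𝓖 p P 𝓕 φ) :
    IsWalshIntegralOf 𝓖 p P 𝓕 W φ I := by
  obtain ⟨l, hl, hlφ⟩ := h.exists_seq
  exact ⟨hI.1, l, hl, hlφ, hI.tendsto hW h𝓕 hφ hlφ⟩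

lemma IsWalshIntegralOf.memLp
    (hφ : AEStronglyMeasurable (fun q : (𝒳 × SpaceTime d) × Ω => φ q.1 q.2) ((control p d).prod P))
    (h : IsWalshIntegralOf 𝓖 p P 𝓕 W φ I) :
    MemLp (fun q : (𝒳 × SpaceTime d) × Ω => φ q.1 q.2) 2 ((control p d).prod P) := by
  obtain ⟨-, l, -, hl, -⟩ := h
  obtain ⟨n, hn⟩ := (hl.eventually (gt_mem_nhds ENNReal.zero_lt_top)).exists
  have h1 : MemLp (fun q : (𝒳 × SpaceTime d) × Ω => φ q.1 q.2 - simpleFun (l n) q.1 q.2) 2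
      ((control p d).prod P) := ⟨hφ.sub (aestronglyMeasurable_simpleFun _), hn⟩
  refine (h1.add (memLp_simpleFun (l n))).congr_norm hφ (ae_of_all _ fun q => ?_)
  simp

lemma tendsto_eLpNorm_mul_add_sub {α : Type*} {mα : MeasurableSpace α} {μ : Measure α} (r : ℝ)
    {f g : α → ℝ} {u v : ℕ → α → ℝ} (hf : AEStronglyMeasurable f μ) (hg : AEStronglyMeasurable g μ)
    (hu : ∀ n, AEStronglyMeasurable (u n) μ) (hv : ∀ n, AEStronglyMeasurable (v n) μ)
    (h1 : Tendsto (fun n => eLpNorm (fun x => f x - u n x) 2 μ) atTop (𝓝 0))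
    (h2 : Tendsto (fun n => eLpNorm (fun x => g x - v n x) 2 μ) atTop (𝓝 0)) :
    Tendsto (fun n => eLpNorm (fun x => r * f x + g x - (r * u n x + v n x)) 2 μ) atTop (𝓝 0) := by
  have h3 := (ENNReal.Tendsto.const_mul h1 (Or.inr (ENNReal.coe_ne_top (r := ‖r‖₊)))).add h2
  simp only [mul_zero, add_zero] at h3
  refine tendsto_of_tendsto_of_tendsto_of_le_of_le tendsto_const_nhds h3 (fun _ => zero_le)
    fun n => ?_
  have h4 := eLpNorm_add_le (p := 2) ((hf.sub (hu n)).const_smul r) (hg.sub (hv n)) (by norm_num)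
  rw [eLpNorm_const_smul] at h4
  refine le_trans (le_of_eq ?_) h4
  congr 1; ext x; simp; ring

lemma IsWalshIntegralOf.add_smul (hW : IsGaussianBasis (control p d) P W)
    {ψ : 𝒳 × SpaceTime d → Ω → ℝ} (r : ℝ)
    (hφ : AEStronglyMeasurable (fun q : (𝒳 × SpaceTime d) × Ω => φ q.1 q.2) ((control p d).prod P))
    (hψ : AEStronglyMeasurable (fun q : (𝒳 × SpaceTime d) × Ω => ψ q.1 q.2) ((control p d).prod P))
    (hI : IsWalshIntegralOf 𝓖 p P 𝓕 W φ I) (hI' : IsWalshIntegralOf 𝓖 p P 𝓕 W ψ I') :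
    IsWalshIntegralOf 𝓖 p P 𝓕 W (fun z ω => r * φ z ω + ψ z ω) (fun ω => r * I ω + I' ω) := by
  obtain ⟨hI2, l, hl, hlφ, hlI⟩ := hI
  obtain ⟨hI2', l', hl', hlφ', hlI'⟩ := hI'
  refine ⟨(hI2.const_mul r).add hI2', fun n => (l n).map (Elementary.smul r) ++ l' n, ?_, ?_, ?_⟩
  · intro n e he
    rcases List.mem_append.1 he with he | he
    · obtain ⟨e', he', rfl⟩ := List.mem_map.1 he
      exact (hl n e' he').const_mul r
    · exact hl' n e he
  · simp only [simpleFun_append, simpleFun_smul]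
    exact tendsto_eLpNorm_mul_add_sub r hφ hψ (fun n => aestronglyMeasurable_simpleFun (l n))
      (fun n => aestronglyMeasurable_simpleFun (l' n)) hlφ hlφ'
  · simp only [simpleIntegral_append, simpleIntegral_smul]
    exact tendsto_eLpNorm_mul_add_sub r hI2.aestronglyMeasurable hI2'.aestronglyMeasurable
      (fun n => (memLp_simpleIntegral hW (l n)).aestronglyMeasurable)
      (fun n => (memLp_simpleIntegral hW (l' n)).aestronglyMeasurable) hlI hlI'

lemma IsWalshIntegralOf.sum (hW : IsGaussianBasis (control p d) P W) {ι : Type*} (s : Finset ι)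
    (r : ι → ℝ) {φ : ι → 𝒳 × SpaceTime d → Ω → ℝ} {I : ι → Ω → ℝ}
    (hφ : ∀ i, AEStronglyMeasurable (fun q : (𝒳 × SpaceTime d) × Ω => φ i q.1 q.2)
      ((control p d).prod P))
    (hI : ∀ i, IsWalshIntegralOf 𝓖 p P 𝓕 W (φ i) (I i)) :
    IsWalshIntegralOf 𝓖 p P 𝓕 W (fun z ω => ∑ i ∈ s, r i * φ i z ω)
      (fun ω => ∑ i ∈ s, r i * I i ω) := by
  classical
  induction s using Finset.induction_on with
  | empty => simpa using! IsWalshIntegralOf.zero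
  | insert i s hi ih =>
    simp_rw [Finset.sum_insert hi]
    exact (hI i).add_smul hW (r i) (hφ i)
      (Finset.aestronglyMeasurable_fun_sum s fun j _ => (hφ j).const_mul (r j)) ih

end Walsh

/-! ### Conditional Gaussianity and characteristic functions of Walsh integrals. -/

section CharFun

/-- Integrating out the second of two independent random vectors. -/
lemma integral_comp_of_indepFun {Ω α β : Type*} {mΩ : MeasurableSpace Ω} [MeasurableSpace α]
    [MeasurableSpace β] {P : Measure Ω} [IsProbabilityMeasure P] {Y : Ω → α} {V : Ω → β}
    (hY : Measurable Y) (hV : Measurable V) (h : IndepFun Y V P) {F : α × β → ℂ}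
    (hF : Measurable F) (hb : ∀ x, ‖F x‖ ≤ 1) :
    ∫ ω, F (Y ω, V ω) ∂P = ∫ ω, ∫ ω', F (Y ω, V ω') ∂P ∂P := by
  have hmap := (indepFun_iff_map_prod_eq_prod_map_map hY.aemeasurable hV.aemeasurable).1 h
  have := Measure.isProbabilityMeasure_map (μ := P) hY.aemeasurable
  have := Measure.isProbabilityMeasure_map (μ := P) hV.aemeasurable
  have hint : Integrable F ((P.map Y).prod (P.map V)) :=
    Integrable.of_bound hF.aestronglyMeasurable 1 (ae_of_all _ hb)
  rw [← integral_map (f := F) (hY.prodMk hV).aemeasurable hF.aestronglyMeasurable, hmap,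
    integral_prod _ hint, integral_map hY.aemeasurable
      (hint.integral_prod_left.aestronglyMeasurable)]
  refine integral_congr_ae (ae_of_all _ fun ω => ?_)
  exact integral_map hV.aemeasurable (hF.comp measurable_prodMk_left).aestronglyMeasurable

variable {𝒳 Ω : Type*} [MeasurableSpace 𝒳] {𝓖 : MeasurableSpace Ω} {mΩ : MeasurableSpace Ω}
  {p : Measure 𝒳} {P : Measure Ω} {𝓕 : Filtration ℝ mΩ} {d : ℕ}
  [IsProbabilityMeasure p] [IsProbabilityMeasure P]
  {W : Set (𝒳 × SpaceTime d) → Ω → ℝ} {φ : 𝒳 × SpaceTime d → Ω → ℝ} {I : Ω → ℝ}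

/-- Conditionally on `𝓖`, the integral of a simple integrand with `𝓖`-measurable coefficients is
Gaussian. -/
lemma integral_exp_simpleIntegral (hW : IsGaussianBasis (control p d) P W) 
    (hind : Indep 𝓖 (MeasurableSpace.comap
      (fun ω (A : {A : Set (𝒳 × SpaceTime d) // IsBounded (control p d) A}) => W A ω)
      inferInstance) P) (l : List (Elementary p 𝓕 d)) (hl : ∀ e ∈ l, Measurable[𝓖] e.Y) :
    ∫ ω, Complex.exp ((simpleIntegral W l ω : ℂ) * Complex.I) ∂P =
      ∫ ω, ((Real.exp (-(∫ z, simpleFun l z ω ^ 2 ∂(control p d)) / 2) : ℝ) : ℂ) ∂P := by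
  let Y : Ω → Fin l.length → ℝ := fun ω i => (l.get i).Y ω
  let V : Ω → Fin l.length → ℝ := fun ω i => W (l.get i).support ω
  have hY : Measurable Y := measurable_pi_lambda _ fun i => (l.get i).measurable_coeff
  have hV : Measurable V := measurable_pi_lambda _ fun i =>
    hW.measurable _ (l.get i).isBounded_support
  have hYG : Measurable[𝓖] Y :=
    @measurable_pi_lambda _ _ _ 𝓖 _ _ fun i => hl _ (List.get_mem l i)
  have hYV : IndepFun Y V P := by
    rw [IndepFun_iff_Indep]
    refine indep_of_indep_of_le_left (indep_of_indep_of_le_right hind ?_) hYG.comap_le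
    rw [← measurable_iff_comap_le]
    refine @measurable_pi_lambda _ _ _ (MeasurableSpace.comap _ _) _ _ fun i => ?_
    exact (measurable_pi_apply (X := fun _ : {A : Set (𝒳 × SpaceTime d) //
      IsBounded (control p d) A} => ℝ) ⟨_, (l.get i).isBounded_support⟩).comp (comap_measurable _)
  have hI : ∀ ω, simpleIntegral W l ω = ∑ i, Y ω i * V ω i := fun ω => by
    rw [simpleIntegral, ← Fin.sum_univ_fun_getElem]; rfl
  have hS : ∀ z ω, simpleFun l z ω = ∑ i, ((l.get i).support).indicator (fun _ => Y ω i) z :=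
    fun z ω => by rw [simpleFun, ← Fin.sum_univ_fun_getElem]; rfl
  simp_rw [hI, hS]
  -- The coefficients are frozen at the outer ω, so the inner integral concerns a deterministic
  -- linear combination of values of W.
  rw [integral_comp_of_indepFun (F := fun x : (Fin l.length → ℝ) × (Fin l.length → ℝ) =>
    Complex.exp (((∑ i, x.1 i * x.2 i : ℝ) : ℂ) * Complex.I)) hY hV hYV (by fun_prop)
    (fun x => (Complex.norm_exp_ofReal_mul_I _).le)]
  refine integral_congr_ae (ae_of_all _ fun ω => ?_)
  exact hW.integral_exp_sum (fun i => (l.get i).support) (fun i => (l.get i).isBounded_support)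
    (Y ω)

lemma norm_exp_mul_I_sub_le (a b : ℝ) :
    ‖Complex.exp (a * Complex.I) - Complex.exp (b * Complex.I)‖ ≤ |a - b| := by
  have h : Complex.exp (a * Complex.I) - Complex.exp (b * Complex.I) =
      Complex.exp (b * Complex.I) * (Complex.exp (Complex.I * ((a - b : ℝ) : ℂ)) - 1) := by
    rw [mul_sub, ← Complex.exp_add, mul_one]
    congr 2
    push_cast; ring
  rw [h, norm_mul, Complex.norm_exp_ofReal_mul_I, one_mul]
  exact Real.norm_exp_I_mul_ofReal_sub_one_le

/-- On the half-line exp(-x/2) is even ½-Lipschitz; any constant suffices for passing to the limit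
in the conditional variance. -/
lemma abs_exp_neg_sub_le {a b : ℝ} (ha : 0 ≤ a) (hb : 0 ≤ b) :
    |Real.exp (-a / 2) - Real.exp (-b / 2)| ≤ |a - b| := by
  wlog h : a ≤ b generalizing a b
  · rw [abs_sub_comm, abs_sub_comm a b]; exact this hb ha (le_of_not_ge h)
  have h1 : Real.exp (-b / 2) ≤ Real.exp (-a / 2) := Real.exp_le_exp.2 (by linarith)
  rw [abs_of_nonneg (by linarith), abs_sub_comm, abs_of_nonneg (by linarith)]
  have h2 : Real.exp (-b / 2) = Real.exp (-a / 2) * Real.exp (-(b - a) / 2) := by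
    rw [← Real.exp_add]; congr 1; ring
  have h3 := Real.add_one_le_exp (-(b - a) / 2)
  have h4 : Real.exp (-a / 2) ≤ 1 := Real.exp_le_one_iff.2 (by linarith)
  have h5 := Real.exp_pos (-a / 2)
  rw [h2]
  nlinarith

/-- Squares converge in `L¹` along sequences that converge in `L²`. -/
lemma tendsto_lintegral_sq_sub_sq {α : Type*} {mα : MeasurableSpace α} {μ : Measure α}
    {f : α → ℝ} {u : ℕ → α → ℝ} (hf : MemLp f 2 μ) (hu : ∀ n, MemLp (u n) 2 μ)
    (h : Tendsto (fun n => eLpNorm (fun x => f x - u n x) 2 μ) atTop (𝓝 0)) :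
    Tendsto (fun n => ∫⁻ x, ‖f x ^ 2 - u n x ^ 2‖ₑ ∂μ) atTop (𝓝 0) := by
  have hb : ∀ n, ∫⁻ x, ‖f x ^ 2 - u n x ^ 2‖ₑ ∂μ ≤
      eLpNorm (fun x => f x - u n x) 2 μ *
        (2 * eLpNorm f 2 μ + eLpNorm (fun x => f x - u n x) 2 μ) := by
    intro n
    have hs := hf.sub (hu n)
    calc ∫⁻ x, ‖f x ^ 2 - u n x ^ 2‖ₑ ∂μ
        = eLpNorm (fun x => (f x - u n x) * (f x + u n x)) 1 μ := by
          rw [eLpNorm_one_eq_lintegral_enorm]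
          refine lintegral_congr fun x => ?_
          congr 1; ring
      _ ≤ eLpNorm (fun x => f x - u n x) 2 μ * eLpNorm (fun x => f x + u n x) 2 μ :=
          eLpNorm_smul_le_mul_eLpNorm (p := 2) (q := 2) (r := 1) (φ := fun x => f x - u n x)
            (f := fun x => f x + u n x) (hf.add (hu n)).aestronglyMeasurable
            hs.aestronglyMeasurable
      _ ≤ _ := by
          gcongr
          -- Writing f + u = 2f - (f - u) avoids a separate uniform bound on the norms of the `u n`.
          have e : (fun x => f x + u n x) = (f + f) - (fun x => f x - u n x) := by
            ext x; simp
          rw [e, two_mul]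
          refine (eLpNorm_sub_le (hf.add hf).aestronglyMeasurable hs.aestronglyMeasurable
            (by norm_num)).trans ?_
          refine add_le_add ?_ le_rfl
          exact eLpNorm_add_le hf.aestronglyMeasurable hf.aestronglyMeasurable (by norm_num)
  have hlim := ENNReal.Tendsto.mul h (Or.inr (by
      simpa using ENNReal.mul_ne_top (by norm_num) hf.eLpNorm_ne_top))
    (tendsto_const_nhds.add h) (Or.inr ENNReal.zero_ne_top) (b := 2 * eLpNorm f 2 μ + 0)
  rw [zero_mul] at hlim
  exact tendsto_of_tendsto_of_tendsto_of_le_of_le tendsto_const_nhds hlim (fun _ => zero_le) hb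

/-- Conditionally on `𝓖`, Walsh integrals of suitable integrands are Gaussian. -/
lemma IsWalshIntegralOf.integral_exp (hW : IsGaussianBasis (control p d) P W) 
    (hind : Indep 𝓖 (MeasurableSpace.comap
      (fun ω (A : {A : Set (𝒳 × SpaceTime d) // IsBounded (control p d) A}) => W A ω)
      inferInstance) P)
    (hφ : AEStronglyMeasurable (fun q : (𝒳 × SpaceTime d) × Ω => φ q.1 q.2) ((control p d).prod P))
    (hI : IsWalshIntegralOf 𝓖 p P 𝓕 W φ I) :
    ∫ ω, Complex.exp ((I ω : ℂ) * Complex.I) ∂P =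
      ∫ ω, ((Real.exp (-(∫ z, φ z ω ^ 2 ∂(control p d)) / 2) : ℝ) : ℂ) ∂P := by
  have hφ2 := hI.memLp hφ
  obtain ⟨hI2, l, hl, hlφ, hlI⟩ := hI
  have hL : Tendsto (fun n => ∫ ω, Complex.exp ((simpleIntegral W (l n) ω : ℂ) * Complex.I) ∂P)
      atTop (𝓝 (∫ ω, Complex.exp ((I ω : ℂ) * Complex.I) ∂P)) := by
    have hm : ∀ {J : Ω → ℝ}, AEStronglyMeasurable J P →
        AEStronglyMeasurable (fun ω => Complex.exp ((J ω : ℂ) * Complex.I)) P := fun hJ =>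
      (by fun_prop : Continuous fun x : ℝ => Complex.exp ((x : ℂ) * Complex.I)).comp_aestronglyMeasurable
        hJ
    refine tendsto_integral_of_L1 _ (hm hI2.aestronglyMeasurable) (.of_forall fun n =>
      Integrable.of_bound (hm (memLp_simpleIntegral hW (l n)).aestronglyMeasurable) 1
        (ae_of_all _ fun ω => (Complex.norm_exp_ofReal_mul_I _).le)) ?_
    -- The map x ↦ exp(ix) is 1-Lipschitz, and on a probability space the L¹ norm is at most the L²
    -- norm.
    refine tendsto_of_tendsto_of_tendsto_of_le_of_le tendsto_const_nhds hlI (fun _ => zero_le)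
      fun n => ?_
    calc ∫⁻ ω, ‖Complex.exp ((simpleIntegral W (l n) ω : ℂ) * Complex.I) -
          Complex.exp ((I ω : ℂ) * Complex.I)‖ₑ ∂P
        ≤ ∫⁻ ω, ‖I ω - simpleIntegral W (l n) ω‖ₑ ∂P := by
          refine lintegral_mono fun ω => ?_
          rw [← enorm_neg (I ω - _), neg_sub, enorm_le_iff_norm_le]
          exact norm_exp_mul_I_sub_le _ _
      _ = eLpNorm (fun ω => I ω - simpleIntegral W (l n) ω) 1 P :=
          eLpNorm_one_eq_lintegral_enorm.symm
      _ ≤ _ := eLpNorm_le_eLpNorm_of_exponent_le (by norm_num)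
          (hI2.sub (memLp_simpleIntegral hW (l n))).aestronglyMeasurable
  have hR : Tendsto (fun n => ∫ ω, ((Real.exp
      (-(∫ z, simpleFun (l n) z ω ^ 2 ∂(control p d)) / 2) : ℝ) : ℂ) ∂P) atTop
      (𝓝 (∫ ω, ((Real.exp (-(∫ z, φ z ω ^ 2 ∂(control p d)) / 2) : ℝ) : ℂ) ∂P)) := by
    have hm : ∀ {ψ : 𝒳 × SpaceTime d → Ω → ℝ},
        MemLp (fun q : (𝒳 × SpaceTime d) × Ω => ψ q.1 q.2) 2 ((control p d).prod P) →
        AEStronglyMeasurable (fun ω => ((Real.exp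
          (-(∫ z, ψ z ω ^ 2 ∂(control p d)) / 2) : ℝ) : ℂ)) P := fun {ψ} h =>
      (by fun_prop : Continuous fun x : ℝ => ((Real.exp
        (-x / 2) : ℝ) : ℂ)).comp_aestronglyMeasurable
        (h.integrable_sq.integral_prod_right).aestronglyMeasurable
    refine tendsto_integral_of_L1 _ (hm hφ2) (.of_forall fun n =>
      Integrable.of_bound (hm (memLp_simpleFun (l n))) 1 (ae_of_all _ fun ω => ?_)) ?_
    · rw [Complex.norm_real, Real.norm_eq_abs, Real.abs_exp, Real.exp_le_one_iff]
      have : 0 ≤ ∫ z, simpleFun (l n) z ω ^ 2 ∂(control p d) :=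
        integral_nonneg fun _ => sq_nonneg _
      linarith
    -- For almost every ω the exponentials differ by at most the L¹(c) distance of the squares;
    -- integrating over ω gives an L¹ distance on the product, which tends to 0.
    refine tendsto_of_tendsto_of_tendsto_of_le_of_le tendsto_const_nhds
      (tendsto_lintegral_sq_sub_sq hφ2 (fun n => memLp_simpleFun (l n)) hlφ) (fun _ => zero_le)
      fun n => ?_
    have i1 := hφ2.integrable_sq
    have i2 := (memLp_simpleFun (P := P) (l n)).integrable_sq
    rw [lintegral_prod_symm (fun q : (𝒳 × SpaceTime d) × Ω =>
      ‖φ q.1 q.2 ^ 2 - simpleFun (l n) q.1 q.2 ^ 2‖ₑ) (i1.sub i2).aestronglyMeasurable.enorm]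
    refine lintegral_mono_ae ?_
    filter_upwards [i1.prod_left_ae, i2.prod_left_ae] with ω h1 h2
    calc _ ≤ ‖∫ z, φ z ω ^ 2 ∂(control p d) - ∫ z, simpleFun (l n) z ω ^ 2 ∂(control p d)‖ₑ := by
          rw [← Complex.ofReal_sub, ← enorm_neg (_ - _ : ℝ), neg_sub, enorm_le_iff_norm_le,
            Complex.norm_real]
          exact abs_exp_neg_sub_le (integral_nonneg fun _ => sq_nonneg _)
            (integral_nonneg fun _ => sq_nonneg _)
      _ = ‖∫ z, (φ z ω ^ 2 - simpleFun (l n) z ω ^ 2) ∂(control p d)‖ₑ := by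
          rw [integral_sub h1 h2]
      _ ≤ _ := enorm_integral_le_lintegral_enorm _
  refine tendsto_nhds_unique hL (hR.congr fun n => ?_)
  exact (integral_exp_simpleIntegral hW hind (l n) (hl n)).symm

end CharFun

/-! ### Predictable stationary fields and mean square continuity. -/

section Field

variable {Ω : Type*} {mΩ : MeasurableSpace Ω} {P : Measure Ω} {𝓕 : Filtration ℝ mΩ} {d : ℕ}
  {σ : SpaceTime d → Ω → ℝ}

lemma predictable_le (𝓕 : Filtration ℝ mΩ) :
    predictable 𝓕 ≤ (inferInstance : MeasurableSpace (ℝ × Ω)) := by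
  refine MeasurableSpace.generateFrom_le ?_
  rintro S ⟨a, b, F, hF, rfl⟩
  exact measurableSet_Ioc.prod (𝓕.le a _ hF)

/-- The section at t of a generator (a, b] × F is either empty or F, and in the latter case a < t,
so F belongs to 𝓕 t. -/
lemma measurable_prodMk_predictable (t : ℝ) :
    Measurable[𝓕 t, predictable 𝓕] (fun ω : Ω => (t, ω)) := by
  refine @measurable_generateFrom _ _ (𝓕 t) _ _ ?_
  rintro S ⟨a, b, F, hF, rfl⟩
  by_cases h : t ∈ Set.Ioc a b
  · rw [Set.mk_preimage_prod_right h]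
    exact 𝓕.mono h.1.le _ hF
  · rw [Set.mk_preimage_prod_right_eq_empty h]
    exact @MeasurableSet.empty _ (𝓕 t)

/-- A predictable field is adapted. -/
lemma IsPredictableField.measurable_section (h : IsPredictableField 𝓕 σ) (s : SpaceTime d) :
    Measurable[𝓕 (s 0)] (σ s) := by
  have h1 : @Measurable Ω ((ℝ × Ω) × (Fin d → ℝ)) (𝓕 (s 0))
      ((predictable 𝓕).prod (inferInstance : MeasurableSpace (Fin d → ℝ)))
      (fun ω => ((s 0, ω), Fin.tail s)) :=
    @Measurable.prodMk _ (𝓕 (s 0)) _ _ (predictable 𝓕) _ _ _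
      (measurable_prodMk_predictable (𝓕 := 𝓕) (s 0)) (@measurable_const _ _ _ (𝓕 (s 0)) _)
  have h2 := @Measurable.comp _ _ _ (𝓕 (s 0)) _ _ _ _ h h1
  have h3 : σ s = (fun q : (ℝ × Ω) × (Fin d → ℝ) => σ (Fin.cons q.1.1 q.2) q.1.2) ∘
      fun ω => ((s 0, ω), Fin.tail s) := by
    ext ω
    simp
  rw [h3]
  exact h2

/-- A predictable field is jointly measurable. -/
lemma IsPredictableField.measurable_uncurry (h : IsPredictableField 𝓕 σ) :
    Measurable fun q : SpaceTime d × Ω => σ q.1 q.2 := by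
  have h0 : Measurable (fun q : (ℝ × Ω) × (Fin d → ℝ) => σ (Fin.cons q.1.1 q.2) q.1.2) :=
    h.mono (sup_le_sup (MeasurableSpace.comap_mono (predictable_le 𝓕)) le_rfl) le_rfl
  have h1 : Measurable fun q : SpaceTime d × Ω => ((q.1 0, q.2), Fin.tail q.1) :=
    (((measurable_pi_apply 0).comp measurable_fst).prodMk measurable_snd).prodMk
      (measurable_pi_lambda _ fun i => (measurable_pi_apply i.succ).comp measurable_fst)
  convert! h0.comp h1 using 2 with q
  simp

lemma IsStrictlyStationary.lintegral_sq (h : IsStrictlyStationary P σ) (s : SpaceTime d) :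
    ∫⁻ ω, ‖σ s ω‖ₑ ^ 2 ∂P = ∫⁻ ω, ‖σ 0 ω‖ₑ ^ 2 ∂P := by
  have h1 := (h 1 (fun _ => 0) s).comp (u := fun x : Fin 1 → ℝ => ‖x 0‖ₑ ^ 2) (by fun_prop)
  simpa [Function.comp_def] using h1.lintegral_eq

lemma IsStrictlyStationary.lintegral_sub_sq (h : IsStrictlyStationary P σ) (s v : SpaceTime d) :
    ∫⁻ ω, ‖σ (s + v) ω - σ s ω‖ₑ ^ 2 ∂P = ∫⁻ ω, ‖σ v ω - σ 0 ω‖ₑ ^ 2 ∂P := by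
  have h1 := (h 2 ![v, 0] s).comp (u := fun x : Fin 2 → ℝ => ‖x 0 - x 1‖ₑ ^ 2) (by fun_prop)
  simpa [Function.comp_def, add_comm s v] using h1.lintegral_eq

lemma eLpNorm_two_sq {α : Type*} {mα : MeasurableSpace α} {μ : Measure α} (f : α → ℝ) :
    eLpNorm f 2 μ ^ 2 = ∫⁻ x, ‖f x‖ₑ ^ 2 ∂μ := by
  have := eLpNorm_nnreal_pow_eq_lintegral (f := f) (μ := μ) (p := 2) (by norm_num)
  simpa using this

lemma tendsto_zero_of_tendsto_sq {ι : Type*} {l : Filter ι} {u : ι → ℝ≥0∞}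
    (h : Tendsto (fun i => u i ^ 2) l (𝓝 0)) : Tendsto u l (𝓝 0) := by
  have h1 := h.ennrpow_const (1 / 2 : ℝ)
  rw [ENNReal.zero_rpow_of_pos (by norm_num)] at h1
  refine h1.congr fun i => ?_
  rw [← ENNReal.rpow_natCast, ← ENNReal.rpow_mul]
  norm_num

/-- Translations act continuously on square integrable functions. -/
lemma tendsto_lintegral_translate {n : ℕ} {f : (Fin n → ℝ) → ℝ} (hf : MemLp f 2 volume) :
    Tendsto (fun v : Fin n → ℝ => ∫⁻ s, ‖f (s + v) - f s‖ₑ ^ 2) (𝓝 0) (𝓝 0) := by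
  let T : (Fin n → ℝ) → C(Fin n → ℝ, Fin n → ℝ) := fun v => ⟨fun s => s + v, by fun_prop⟩
  have hT : Tendsto T (𝓝 0) (𝓝 (T 0)) := by
    have : Continuous T := ContinuousMap.continuous_of_continuous_uncurry _
      (by exact continuous_snd.add continuous_fst)
    exact this.tendsto 0
  have hTm : ∀ v, MeasurePreserving (T v) volume volume := fun v =>
    measurePreserving_add_right volume v
  have h := (tendsto_const_nhds (x := hf.toLp)).compMeasurePreservingLp hT hTm (hTm 0) (by simp)
  have h2 := (tendsto_iff_edist_tendsto_0.1 h)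
  have h3 := ENNReal.Tendsto.pow (n := 2) h2
  rw [zero_pow two_ne_zero] at h3
  refine h3.congr fun v => ?_
  rw [Lp.toLp_compMeasurePreserving hf (hTm v), Lp.toLp_compMeasurePreserving hf (hTm 0),
    Lp.edist_toLp_toLp, eLpNorm_two_sq]
  simp [T]

lemma enorm_sub_sq_le (a b : ℝ) : ‖a - b‖ₑ ^ 2 ≤ 2 * ‖a‖ₑ ^ 2 + 2 * ‖b‖ₑ ^ 2 := by
  have h : (a - b) ^ 2 ≤ 2 * a ^ 2 + 2 * b ^ 2 := by nlinarith [sq_nonneg (a + b)]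
  simp_rw [← enorm_pow, Real.enorm_of_nonneg (sq_nonneg _)]
  rw [← ENNReal.ofReal_ofNat 2, ← ENNReal.ofReal_mul (by norm_num),
    ← ENNReal.ofReal_mul (by norm_num), ← ENNReal.ofReal_add (by positivity) (by positivity)]
  exact ENNReal.ofReal_le_ofReal h

/-- A jointly measurable stationary field with finite second moments is mean square continuous. -/
lemma IsStrictlyStationary.tendsto_lintegral_sub_sq [IsProbabilityMeasure P]
    (h : IsStrictlyStationary P σ)
    (hm : Measurable fun q : SpaceTime d × Ω => σ q.1 q.2) (h2 : ∫⁻ ω, ‖σ 0 ω‖ₑ ^ 2 ∂P < ∞) :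
    Tendsto (fun v => ∫⁻ ω, ‖σ v ω - σ 0 ω‖ₑ ^ 2 ∂P) (𝓝 0) (𝓝 0) := by
  set B : Set (SpaceTime d) := Metric.ball 0 1
  set B2 : Set (SpaceTime d) := Metric.ball 0 2
  -- Cutting off outside the ball of radius 2 makes almost every path square integrable on the whole
  -- space, so that continuity of translations in L² applies path by path.
  obtain ⟨f, hf, hf1, hf0⟩ : ∃ f : SpaceTime d → Ω → ℝ,
      Measurable (fun q : SpaceTime d × Ω => f q.1 q.2) ∧ (∀ s ∈ B2, f s = σ s) ∧
      ∀ s ∉ B2, f s = 0 := by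
    classical
    refine ⟨fun s ω => if s ∈ B2 then σ s ω else 0, ?_, fun s hs => ?_, fun s hs => ?_⟩
    · exact Measurable.ite (measurable_fst Metric.isOpen_ball.measurableSet) hm measurable_const
    · simp [hs]
    · ext ω; simp [hs]
  have hf2 : Measurable fun q : SpaceTime d × Ω => ‖f q.1 q.2‖ₑ ^ 2 :=
    hf.enorm.pow_const 2
  have hft : ∀ v, Measurable fun q : SpaceTime d × Ω => ‖f (q.1 + v) q.2 - f q.1 q.2‖ₑ ^ 2 := by
    intro v
    have : Measurable fun q : SpaceTime d × Ω => f (q.1 + v) q.2 := by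
      have hv : Measurable fun q : SpaceTime d × Ω => (q.1 + v, q.2) :=
        ((measurable_add_const v).comp measurable_fst).prodMk measurable_snd
      exact hf.comp hv
    exact (this.sub hf).enorm.pow_const 2
  have hfin : ∫⁻ ω, (∫⁻ s, ‖f s ω‖ₑ ^ 2) ∂P < ∞ := by
    rw [lintegral_lintegral_swap (f := fun ω s => ‖f s ω‖ₑ ^ 2) (hf2.comp measurable_swap).aemeasurable]
    have : ∀ s, ∫⁻ ω, ‖f s ω‖ₑ ^ 2 ∂P = B2.indicator (fun _ => ∫⁻ ω, ‖σ 0 ω‖ₑ ^ 2 ∂P) s := by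
      intro s
      by_cases hs : s ∈ B2
      · rw [Set.indicator_of_mem hs, hf1 s hs, h.lintegral_sq s]
      · simp [Set.indicator_of_notMem hs, hf0 s hs]
    simp_rw [this]
    rw [lintegral_indicator_const Metric.isOpen_ball.measurableSet]
    exact ENNReal.mul_lt_top h2 measure_ball_lt_top
  have key : Tendsto (fun v => ∫⁻ ω, (∫⁻ s, ‖f (s + v) ω - f s ω‖ₑ ^ 2) ∂P) (𝓝 0)
      (𝓝 (∫⁻ ω, 0 ∂P)) := by
    refine tendsto_lintegral_filter_of_dominated_convergence
      (fun ω => 4 * ∫⁻ s, ‖f s ω‖ₑ ^ 2) (.of_forall fun v => (hft v).lintegral_prod_left')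
      (.of_forall fun v => ae_of_all _ fun ω => ?_) ?_ ?_
    · have hfω : Measurable fun s => ‖f s ω‖ₑ ^ 2 := hf2.comp measurable_prodMk_right
      calc ∫⁻ s, ‖f (s + v) ω - f s ω‖ₑ ^ 2
          ≤ ∫⁻ s, (2 * ‖f (s + v) ω‖ₑ ^ 2 + 2 * ‖f s ω‖ₑ ^ 2) :=
            lintegral_mono fun s => enorm_sub_sq_le _ _
        _ = 4 * ∫⁻ s, ‖f s ω‖ₑ ^ 2 := by
            rw [lintegral_add_right _ (hfω.const_mul 2), lintegral_const_mul 2 hfω,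
              lintegral_add_right_eq_self (fun s => 2 * ‖f s ω‖ₑ ^ 2) v,
              lintegral_const_mul 2 hfω, ← add_mul]
            norm_num
    · rw [lintegral_const_mul _ hf2.lintegral_prod_left']
      exact ENNReal.mul_ne_top (by norm_num) hfin.ne
    · have hfin' : ∀ᵐ ω ∂P, ∫⁻ s, ‖f s ω‖ₑ ^ 2 < ∞ :=
        ae_lt_top hf2.lintegral_prod_left' hfin.ne
      filter_upwards [hfin'] with ω hω
      have hfω : Measurable fun s => f s ω := hf.comp measurable_prodMk_right
      refine tendsto_lintegral_translate (f := fun s => f s ω) ⟨hfω.aestronglyMeasurable, ?_⟩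
      rw [← eLpNorm_two_sq] at hω
      exact lt_top_iff_ne_top.2 fun h => by simp [h] at hω
  rw [lintegral_zero] at key
  have hB0 : volume B ≠ 0 := (Metric.measure_ball_pos _ _ one_pos).ne'
  have hBt : volume B ≠ ∞ := measure_ball_lt_top.ne
  have key2 := ENNReal.Tendsto.const_mul (a := (volume B)⁻¹) key (Or.inr (by simpa using hB0))
  rw [mul_zero] at key2
  refine tendsto_of_tendsto_of_tendsto_of_le_of_le' tendsto_const_nhds key2
    (.of_forall fun _ => zero_le) ?_
  -- By stationarity the mean square increment is the same at every s, hence equals its average over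
  -- the unit ball `B`. For |v| < 1 both s and s + v stay in `B2`, where `f` is σ.
  filter_upwards [Metric.ball_mem_nhds (0 : SpaceTime d) one_pos] with v hv
  rw [← ENNReal.div_eq_inv_mul, ENNReal.le_div_iff_mul_le (Or.inl hB0) (Or.inl hBt),
    lintegral_lintegral_swap (f := fun ω s => ‖f (s + v) ω - f s ω‖ₑ ^ 2)
      ((hft v).comp measurable_swap).aemeasurable,
    ← setLIntegral_const]
  rw [← lintegral_indicator Metric.isOpen_ball.measurableSet]
  refine lintegral_mono fun s => ?_
  by_cases hs : s ∈ B
  · rw [Set.indicator_of_mem hs, ← h.lintegral_sub_sq s v]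
    have h1 : s ∈ B2 := Metric.ball_subset_ball (by norm_num) hs
    have h3 : s + v ∈ B2 := by
      simp only [B, B2, mem_ball_zero_iff] at *
      linarith [norm_add_le s v]
    rw [hf1 _ h1, hf1 _ h3]
  · rw [Set.indicator_of_notMem hs]; exact zero_le

end Field

/-! ### Closure properties of admissible integrands; constant coefficients on a cell. -/

section Approx

variable {𝒳 Ω : Type*} [MeasurableSpace 𝒳] {𝓖 : MeasurableSpace Ω} {mΩ : MeasurableSpace Ω}
  {p : Measure 𝒳} {P : Measure Ω} {𝓕 : Filtration ℝ mΩ} {d : ℕ}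
  {φ ψ Φ : 𝒳 × SpaceTime d → Ω → ℝ}

variable (𝓖) in
/-- Measurable `L²` limits of simple integrands with `𝓖`-measurable coefficients. -/
def IsAdmissible (p : Measure 𝒳) (P : Measure Ω) (𝓕 : Filtration ℝ mΩ)
    (φ : 𝒳 × SpaceTime d → Ω → ℝ) : Prop :=
  Measurable (fun q : (𝒳 × SpaceTime d) × Ω => φ q.1 q.2) ∧ IsApproximable 𝓖 p P 𝓕 φ

lemma isAdmissible_zero : IsAdmissible 𝓖 p P 𝓕 (fun (_ : 𝒳 × SpaceTime d) _ => 0) :=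
  ⟨measurable_const, fun ε _ => ⟨[], by simp, by simp [simpleFun]⟩⟩

lemma IsAdmissible.congr (hφ : IsAdmissible 𝓖 p P 𝓕 φ) (h : ∀ z ω, φ z ω = ψ z ω) :
    IsAdmissible 𝓖 p P 𝓕 ψ := by
  have : φ = ψ := funext fun z => funext fun ω => h z ω
  rwa [← this]

variable [IsProbabilityMeasure p]

lemma IsAdmissible.of_eLpNorm_sub_le (hφ : Measurable fun q : (𝒳 × SpaceTime d) × Ω => φ q.1 q.2)
    (h : ∀ ε : ℝ≥0∞, ε ≠ 0 → ∃ ψ, IsAdmissible 𝓖 p P 𝓕 ψ ∧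
      eLpNorm (fun q : (𝒳 × SpaceTime d) × Ω => φ q.1 q.2 - ψ q.1 q.2) 2
        ((control p d).prod P) ≤ ε) : IsAdmissible 𝓖 p P 𝓕 φ := by
  refine ⟨hφ, fun ε hε => ?_⟩
  have hε2 : ε / 2 ≠ 0 := (ENNReal.half_pos hε).ne'
  obtain ⟨ψ, ⟨hψ, hψl⟩, hle⟩ := h (ε / 2) hε2
  obtain ⟨l, hl, hll⟩ := hψl (ε / 2) hε2
  refine ⟨l, hl, ?_⟩
  have h1 := eLpNorm_add_le (p := 2) (μ := (control p d).prod P) (hφ.sub hψ).aestronglyMeasurable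
    (hψ.sub (measurable_simpleFun l)).aestronglyMeasurable (by norm_num)
  calc _ = _ := by congr 1; ext q; simp
    _ ≤ _ := h1
    _ ≤ ε / 2 + ε / 2 := add_le_add hle hll
    _ = ε := ENNReal.add_halves ε

lemma IsAdmissible.of_tendsto (hφ : Measurable fun q : (𝒳 × SpaceTime d) × Ω => φ q.1 q.2)
    {u : ℕ → 𝒳 × SpaceTime d → Ω → ℝ} (hu : ∀ n, IsAdmissible 𝓖 p P 𝓕 (u n))
    (h : Tendsto (fun n => ∫⁻ q, ‖φ q.1 q.2 - u n q.1 q.2‖ₑ ^ 2 ∂((control p d).prod P)) atTop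
      (𝓝 0)) : IsAdmissible 𝓖 p P 𝓕 φ := by
  refine .of_eLpNorm_sub_le hφ fun ε hε => ?_
  have h1 : Tendsto (fun n => eLpNorm (fun q : (𝒳 × SpaceTime d) × Ω =>
      φ q.1 q.2 - u n q.1 q.2) 2 ((control p d).prod P)) atTop (𝓝 0) := by
    apply tendsto_zero_of_tendsto_sq
    simpa only [eLpNorm_two_sq] using h
  obtain ⟨n, hn⟩ := (h1.eventually (gt_mem_nhds (pos_iff_ne_zero.2 hε))).exists
  exact ⟨u n, hu n, hn.le⟩

/-- Dominated convergence with |φ - uₙ|² ≤ 4Φ², the bound on φ being inherited from the limit. -/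
lemma IsAdmissible.of_dominated (hφ : Measurable fun q : (𝒳 × SpaceTime d) × Ω => φ q.1 q.2)
    {u : ℕ → 𝒳 × SpaceTime d → Ω → ℝ} (hu : ∀ n, IsAdmissible 𝓖 p P 𝓕 (u n))
    (hΦ : MemLp (fun q : (𝒳 × SpaceTime d) × Ω => Φ q.1 q.2) 2 ((control p d).prod P))
    (hb : ∀ n z ω, |u n z ω| ≤ |Φ z ω|)
    (hlim : ∀ z ω, Tendsto (fun n => u n z ω) atTop (𝓝 (φ z ω))) : IsAdmissible 𝓖 p P 𝓕 φ := by
  refine .of_tendsto hφ hu ?_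
  have h0 : (0 : ℝ≥0∞) = ∫⁻ _, 0 ∂((control p d).prod P) := by simp
  rw [h0]
  refine tendsto_lintegral_of_dominated_convergence
    (fun q : (𝒳 × SpaceTime d) × Ω => 4 * ‖Φ q.1 q.2‖ₑ ^ 2)
    (fun n => (hφ.sub (hu n).1).enorm.pow_const 2) (fun n => ae_of_all _ fun q => ?_) ?_
    (ae_of_all _ fun q => ?_)
  · have hφb : |φ q.1 q.2| ≤ |Φ q.1 q.2| :=
      le_of_tendsto' (hlim q.1 q.2).abs fun n => hb n q.1 q.2
    calc _ ≤ 2 * ‖φ q.1 q.2‖ₑ ^ 2 + 2 * ‖u n q.1 q.2‖ₑ ^ 2 := enorm_sub_sq_le _ _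
      _ ≤ 2 * ‖Φ q.1 q.2‖ₑ ^ 2 + 2 * ‖Φ q.1 q.2‖ₑ ^ 2 := by
          gcongr
          · exact enorm_le_iff_norm_le.2 hφb
          · exact enorm_le_iff_norm_le.2 (hb n q.1 q.2)
      _ = _ := by rw [← add_mul]; norm_num
  · rw [lintegral_const_mul' _ _ (by norm_num), ← eLpNorm_two_sq]
    exact ENNReal.mul_ne_top (by norm_num) (ENNReal.pow_ne_top hΦ.eLpNorm_ne_top)
  · have h1 : Tendsto (fun n => φ q.1 q.2 - u n q.1 q.2) atTop (𝓝 0) := by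
      simpa using (tendsto_const_nhds (x := φ q.1 q.2)).sub (hlim q.1 q.2)
    have h2 := ENNReal.Tendsto.pow (n := 2) h1.enorm
    simpa using h2

lemma IsAdmissible.add_smul (r : ℝ) (hφ : IsAdmissible 𝓖 p P 𝓕 φ)
    (hψ : IsAdmissible 𝓖 p P 𝓕 ψ) : IsAdmissible 𝓖 p P 𝓕 (fun z ω => r * φ z ω + ψ z ω) := by
  obtain ⟨l, hl, hlφ⟩ := hφ.2.exists_seq
  obtain ⟨l', hl', hlψ⟩ := hψ.2.exists_seq
  refine ⟨(hφ.1.const_mul r).add hψ.1, fun ε hε => ?_⟩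
  have h := tendsto_eLpNorm_mul_add_sub r hφ.1.aestronglyMeasurable hψ.1.aestronglyMeasurable
    (fun n => (measurable_simpleFun (l n)).aestronglyMeasurable)
    (fun n => (measurable_simpleFun (l' n)).aestronglyMeasurable) hlφ hlψ
  obtain ⟨n, hn⟩ := (h.eventually (gt_mem_nhds (pos_iff_ne_zero.2 hε))).exists
  refine ⟨(l n).map (Elementary.smul r) ++ l' n, fun e he => ?_, ?_⟩
  · rcases List.mem_append.1 he with he | he
    · obtain ⟨e', he', rfl⟩ := List.mem_map.1 he
      exact (hl n e' he').const_mul r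
    · exact hl' n e he
  · simpa only [simpleFun_append, simpleFun_smul] using hn.le

lemma IsAdmissible.sum {ι : Type*} (s : Finset ι) (r : ι → ℝ) {φ : ι → 𝒳 × SpaceTime d → Ω → ℝ}
    (hφ : ∀ i ∈ s, IsAdmissible 𝓖 p P 𝓕 (φ i)) :
    IsAdmissible 𝓖 p P 𝓕 (fun z ω => ∑ i ∈ s, r i * φ i z ω) := by
  classical
  induction s using Finset.induction_on with
  | empty => simpa using! isAdmissible_zero
  | insert i s hi ih =>
    simp_rw [Finset.sum_insert hi]
    exact (hφ i (by simp)).add_smul (r i) (ih fun j hj => hφ j (by simp [hj]))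

lemma isAdmissible_slab {a b : ℝ} {A : Set (𝒳 × (Fin d → ℝ))}
    (hA : IsBounded (p.prod volume) A) {Y : Ω → ℝ} (hY : Measurable[𝓕 a] Y)
    (hYG : Measurable[𝓖] Y) (hb : ∃ C : ℝ, ∀ ω, |Y ω| ≤ C) :
    IsAdmissible 𝓖 p P 𝓕 (fun z ω => (slab a b A).indicator (fun _ => Y ω) z) := by
  rcases le_total a b with hab | hab
  · let e : Elementary p 𝓕 d := ⟨a, b, hab, A, hA, Y, hY, hb⟩
    have h : ∀ z ω, simpleFun [e] z ω = (slab a b A).indicator (fun _ => Y ω) z := fun z ω => by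
      simp [simpleFun, Elementary.toFun, e]
    refine ⟨by simpa only [h] using measurable_simpleFun [e], fun ε _ => ⟨[e], by simpa [e], ?_⟩⟩
    simp [h]
  -- For b ≤ a the slab is empty. This case does arise, when a half-line in time ends before a cell
  -- begins.
  · refine isAdmissible_zero.congr fun z ω => ?_
    rw [Set.indicator_of_notMem]
    rintro ⟨h1, -⟩
    exact absurd (h1.1.trans_le h1.2) hab.not_gt

/-- The half-open cube of side `δ` with upper corner `v`. -/
def cell {n : ℕ} (v : Fin n → ℝ) (δ : ℝ) : Set (Fin n → ℝ) :=
  {s | ∀ i, s i ∈ Set.Ioc (v i - δ) (v i)}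

lemma measurableSet_cell {n : ℕ} (v : Fin n → ℝ) (δ : ℝ) : MeasurableSet (cell v δ) := by
  have : cell v δ = ⋂ i, (fun s : Fin n → ℝ => s i) ⁻¹' Set.Ioc (v i - δ) (v i) := by
    ext s; simp [cell]
  rw [this]
  exact .iInter fun i => (measurable_pi_apply i) measurableSet_Ioc

lemma volume_cell_lt_top {n : ℕ} (v : Fin n → ℝ) (δ : ℝ) : volume (cell v δ) < ∞ := by
  have : cell v δ ⊆ Set.Icc (fun i => v i - δ) v := fun s hs =>
    ⟨fun i => (hs i).1.le, fun i => (hs i).2⟩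
  exact (measure_mono this).trans_lt (isCompact_Icc.measure_lt_top)

lemma isBounded_snd_preimage {n : ℕ} {C : Set (Fin n → ℝ)}
    (hC : MeasurableSet C) (hC' : volume C < ∞) :
    IsBounded (p.prod volume) (Prod.snd ⁻¹' C) := by
  refine ⟨measurable_snd hC, ?_⟩
  rw [← Set.univ_prod, Measure.prod_prod]
  simpa using hC'

/-- A generating π-system whose members, cut by a cell, are slabs and so carry elementary
integrands. -/
lemma generateFrom_Iic_prod {β : Type*} [mβ : MeasurableSpace β] :
    (inferInstance : MeasurableSpace (ℝ × β)) = MeasurableSpace.generateFrom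
      (Set.image2 (· ×ˢ ·) (Set.range Set.Iic) {t : Set β | MeasurableSet t}) := by
  refine (generateFrom_eq_prod (borel_eq_generateFrom_Iic ℝ).symm
    MeasurableSpace.generateFrom_measurableSet ?_ isCountablySpanning_measurableSet).symm
  refine ⟨fun n : ℕ => Set.Iic (n : ℝ), fun n => ⟨_, rfl⟩, ?_⟩
  ext x
  simpa using exists_nat_ge x

lemma measurable_indicator_uncurry {E : Type*} [MeasurableSpace E] {B : Set E}
    (hB : MeasurableSet B) {F : E → Ω → ℝ} (hF : Measurable fun q : E × Ω => F q.1 q.2) :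
    Measurable fun q : E × Ω => B.indicator (fun z => F z q.2) q.1 := by
  classical
  have : (fun q : E × Ω => B.indicator (fun z => F z q.2) q.1) =
      fun q => if q.1 ∈ B then F q.1 q.2 else 0 := by
    ext q; by_cases h : q.1 ∈ B <;> simp [h]
  rw [this]
  exact Measurable.ite (measurable_fst hB) hF measurable_const

lemma memLp_indicator_coeff {E : Type*} [MeasurableSpace E] {c : Measure E} [SFinite c]
    [SFinite P] {B : Set E} (hB : IsBounded c B) {Y : Ω → ℝ} (hY : MemLp Y 2 P) :
    MemLp (fun q : E × Ω => B.indicator (fun _ => Y q.2) q.1) 2 (c.prod P) := by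
  have e : ∀ q : E × Ω, B.indicator (fun _ => Y q.2) q.1 = B.indicator 1 q.1 * Y q.2 := fun q => by
    by_cases h : q.1 ∈ B <;> simp [h]
  have h1 : MemLp (B.indicator (1 : E → ℝ)) 2 c :=
    memLp_indicator_const 2 hB.1 (1 : ℝ) (Or.inr hB.2.ne)
  simp_rw [e]
  refine (memLp_two_iff_integrable_sq
    (h1.aestronglyMeasurable.comp_fst.mul hY.aestronglyMeasurable.comp_snd)).2 ?_
  simp_rw [Pi.mul_apply]
  simp_rw [mul_pow]
  exact h1.integrable_sq.mul_prod hY.integrable_sq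

/-- Splitting off the time coordinate. -/
def splitTime {𝒳 : Type*} {d : ℕ} (z : 𝒳 × SpaceTime d) : ℝ × (𝒳 × (Fin d → ℝ)) := (z.2 0, (z.1, Fin.tail z.2))

/-- The slab starts at `v 0 - δ` whatever b is, so a coefficient known at that time stays
admissible. -/
lemma splitTime_preimage_inter_cell {𝒳 : Type*} {d : ℕ} (v : SpaceTime d) (δ b : ℝ) (A : Set (𝒳 × (Fin d → ℝ))) :
    splitTime ⁻¹' (Set.Iic b ×ˢ A) ∩ Prod.snd ⁻¹' cell v δ =
      slab (v 0 - δ) (min b (v 0)) (A ∩ Prod.snd ⁻¹' cell (Fin.tail v) δ) := by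
  ext z
  simp only [splitTime, cell, slab, Set.mem_inter_iff, Set.mem_preimage, Set.mem_prod, Set.mem_Iic,
    Set.mem_ofPred_eq, Set.mem_Ioc, le_min_iff, Fin.forall_fin_succ, Fin.tail]
  tauto

lemma measurable_splitTime : Measurable (splitTime : 𝒳 × SpaceTime d → _) :=
  ((measurable_pi_apply 0).comp measurable_snd).prodMk (measurable_fst.prodMk
    (measurable_pi_lambda _ fun i => (measurable_pi_apply i.succ).comp measurable_snd))

lemma exists_eq_splitTime_preimage {B : Set (𝒳 × SpaceTime d)} (hB : MeasurableSet B) :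
    ∃ B' : Set (ℝ × (𝒳 × (Fin d → ℝ))), MeasurableSet B' ∧ B = splitTime ⁻¹' B' := by
  have hj : Measurable fun w : ℝ × (𝒳 × (Fin d → ℝ)) =>
      ((w.2.1, Fin.cons w.1 w.2.2) : 𝒳 × SpaceTime d) := by
    refine (measurable_fst.comp measurable_snd).prodMk (measurable_pi_lambda _ fun i => ?_)
    refine Fin.cases ?_ (fun i => ?_) i
    · simpa using measurable_fst
    · simp only [Fin.cons_succ]
      exact (measurable_pi_apply i).comp (measurable_snd.comp measurable_snd)
  refine ⟨_, hj hB, ?_⟩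
  ext z
  simp [splitTime]

/-- Dynkin's π-λ theorem in `B`. The cell has finite measure, which provides both the complement
step and an L² majorant for countable unions. -/
lemma isAdmissible_inter_cell_of_bounded [IsProbabilityMeasure P]
    (v : SpaceTime d) (δ : ℝ) {Y : Ω → ℝ}
    (hY : Measurable[𝓕 (v 0 - δ)] Y) (hYG : Measurable[𝓖] Y) (hb : ∃ C : ℝ, ∀ ω, |Y ω| ≤ C)
    {B : Set (𝒳 × SpaceTime d)} (hB : MeasurableSet B) :
    IsAdmissible 𝓖 p P 𝓕 (fun z ω => (B ∩ Prod.snd ⁻¹' cell v δ).indicator (fun _ => Y ω) z) := by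
  obtain ⟨B', hB', rfl⟩ := exists_eq_splitTime_preimage hB
  clear hB
  have hYm : Measurable Y := hY.mono (𝓕.le _) le_rfl
  have hbasic : ∀ b, ∀ A : Set (𝒳 × (Fin d → ℝ)), MeasurableSet A → IsAdmissible 𝓖 p P 𝓕
      (fun z ω => (splitTime ⁻¹' (Set.Iic b ×ˢ A) ∩ Prod.snd ⁻¹' cell v δ).indicator
        (fun _ => Y ω) z) := by
    intro b A hA
    simp_rw [splitTime_preimage_inter_cell]
    have hC := isBounded_snd_preimage (p := p) (measurableSet_cell (Fin.tail v) δ)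
      (volume_cell_lt_top (Fin.tail v) δ)
    exact isAdmissible_slab (hC.mono (hA.inter hC.1) Set.inter_subset_right) hY hYG hb
  have huniv : IsAdmissible 𝓖 p P 𝓕
      (fun z ω => ((Prod.snd ⁻¹' cell v δ : Set (𝒳 × SpaceTime d))).indicator
        (fun _ => Y ω) z) := by
    refine (hbasic (v 0) Set.univ .univ).congr fun z ω => ?_
    congr 1
    ext z
    simp only [splitTime, Set.mem_inter_iff, Set.mem_preimage, Set.mem_prod, Set.mem_Iic,
      Set.mem_univ, and_true, and_iff_right_iff_imp]
    exact fun h => (h 0).2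
  have hsub : ∀ (D C : Set (𝒳 × SpaceTime d)) z ω,
      |(D ∩ C).indicator (fun _ => Y ω) z| ≤ |C.indicator (fun _ => Y ω) z| := by
    intro D C z ω
    by_cases hD : z ∈ D <;> by_cases hC : z ∈ C <;> simp [hD, hC]
  have hmem : MemLp (fun q : (𝒳 × SpaceTime d) × Ω =>
      (Prod.snd ⁻¹' cell v δ : Set (𝒳 × SpaceTime d)).indicator (fun _ => Y q.2) q.1) 2
      ((control p d).prod P) := by
    obtain ⟨K, hK⟩ := hb
    exact memLp_indicator_coeff (isBounded_snd_preimage (measurableSet_cell v δ)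
      (volume_cell_lt_top v δ)) (MemLp.of_bound hYm.aestronglyMeasurable K (ae_of_all _ hK))
  induction B', hB' using MeasurableSpace.induction_on_inter generateFrom_Iic_prod
    (isPiSystem_Iic.prod MeasurableSpace.isPiSystem_measurableSet) with
  | empty => exact isAdmissible_zero.congr fun z ω => by simp
  | basic t ht =>
    obtain ⟨_, ⟨b, rfl⟩, A, hA, rfl⟩ := ht
    exact hbasic b A hA
  | compl t ht ih =>
    refine (ih.add_smul (-1) huniv).congr fun z ω => ?_
    by_cases h1 : splitTime z ∈ t <;> by_cases h2 : z ∈ Prod.snd ⁻¹' cell v δ <;>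
      simp [Set.indicator, h1, h2]
  | iUnion f hd hf ih =>
    -- At a point of the disjoint union exactly one summand is nonzero, so the partial sums are 0
    -- until its index has been passed and constant afterwards.
    have hval : ∀ z ω k₀, z ∈ splitTime ⁻¹' (f k₀) ∩ Prod.snd ⁻¹' cell v δ → ∀ n,
        ∑ k ∈ Finset.range n, 1 * (splitTime ⁻¹' (f k) ∩ Prod.snd ⁻¹' cell v δ).indicator
          (fun _ => Y ω) z = if k₀ < n then Y ω else 0 := by
      intro z ω k₀ hz n
      have : ∀ k, 1 * (splitTime ⁻¹' (f k) ∩ Prod.snd ⁻¹' cell v δ).indicator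
          (fun _ => Y ω) z = if k = k₀ then Y ω else 0 := by
        intro k
        split_ifs with h
        · subst h; rw [Set.indicator_of_mem hz, one_mul]
        · rw [Set.indicator_of_notMem, mul_zero]
          exact fun hk => (hd h).le_bot ⟨hk.1, hz.1⟩
      simp [this]
    have hzero : ∀ z ω, (∀ k₀, z ∉ splitTime ⁻¹' (f k₀) ∩ Prod.snd ⁻¹' cell v δ) → ∀ n,
        ∑ k ∈ Finset.range n, 1 * (splitTime ⁻¹' (f k) ∩ Prod.snd ⁻¹' cell v δ).indicator
          (fun _ => Y ω) z = 0 := fun z ω hz n =>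
      Finset.sum_eq_zero fun k _ => by rw [Set.indicator_of_notMem (hz k), mul_zero]
    have hmemU : ∀ z, z ∈ splitTime ⁻¹' (⋃ k, f k) ∩ Prod.snd ⁻¹' cell v δ ↔
        ∃ k, z ∈ splitTime ⁻¹' (f k) ∩ Prod.snd ⁻¹' cell v δ := fun z => by
      simp
    refine IsAdmissible.of_dominated (Φ := fun z ω =>
      (Prod.snd ⁻¹' cell v δ : Set (𝒳 × SpaceTime d)).indicator (fun _ => Y ω) z) ?_ (fun n => IsAdmissible.sum (Finset.range n) (fun _ => 1)
      fun k _ => ih k) hmem ?_ ?_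
    · exact measurable_indicator_uncurry
        ((measurable_splitTime (.iUnion hf)).inter (measurable_snd (measurableSet_cell v δ)))
        (hYm.comp measurable_snd)
    · intro n z ω
      by_cases h : ∃ k, z ∈ splitTime ⁻¹' (f k) ∩ Prod.snd ⁻¹' cell v δ
      · obtain ⟨k, hk⟩ := h
        rw [hval z ω k hk n, Set.indicator_of_mem hk.2]
        split_ifs <;> simp
      · rw [hzero z ω (not_exists.1 h) n]
        simp
    · intro z ω
      by_cases h : ∃ k, z ∈ splitTime ⁻¹' (f k) ∩ Prod.snd ⁻¹' cell v δ
      · obtain ⟨k, hk⟩ := h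
        rw [Set.indicator_of_mem ((hmemU z).2 ⟨k, hk⟩)]
        refine tendsto_const_nhds.congr' ?_
        filter_upwards [eventually_gt_atTop k] with n hn
        rw [hval z ω k hk n, if_pos hn]
      · rw [Set.indicator_of_notMem (mt (hmemU z).1 h)]
        exact tendsto_const_nhds.congr fun n => (hzero z ω (not_exists.1 h) n).symm

end Approx

/-! ### Discretising the field on grids. -/

section ApproxField

variable {𝒳 Ω : Type*} [MeasurableSpace 𝒳] {𝓖 : MeasurableSpace Ω} {mΩ : MeasurableSpace Ω}
  {p : Measure 𝒳} {P : Measure Ω} {𝓕 : Filtration ℝ mΩ} {d : ℕ}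
  [IsProbabilityMeasure p] [IsProbabilityMeasure P]

/-- Elementary coefficients must be bounded, so `Z` is truncated to [-n, n], which preserves both
measurability conditions. -/
lemma isAdmissible_inter_cell (v : SpaceTime d) (δ : ℝ) {Z : Ω → ℝ}
    (hZ : Measurable[𝓕 (v 0 - δ)] Z) (hZG : Measurable[𝓖] Z) (hZ2 : MemLp Z 2 P)
    {B : Set (𝒳 × SpaceTime d)} (hB : MeasurableSet B) :
    IsAdmissible 𝓖 p P 𝓕 (fun z ω => (B ∩ Prod.snd ⁻¹' cell v δ).indicator (fun _ => Z ω) z) := by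
  have hC := isBounded_snd_preimage (p := p) (measurableSet_cell v δ) (volume_cell_lt_top v δ)
  have hBC := hC.mono (hB.inter hC.1) Set.inter_subset_right
  have htr : ∀ {m : MeasurableSpace Ω} (n : ℕ), Measurable[m] Z →
      Measurable[m] fun ω => max (-(n : ℝ)) (min n (Z ω)) := fun n h =>
    measurable_const.max (measurable_const.min h)
  refine IsAdmissible.of_dominated
    (measurable_indicator_uncurry hBC.1 ((hZ.mono (𝓕.le _) le_rfl).comp measurable_snd))
    (fun n => isAdmissible_inter_cell_of_bounded (Y := fun ω => max (-(n : ℝ)) (min n (Z ω)))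
      v δ (htr n hZ) (htr n hZG) ⟨n, fun ω => ?_⟩ hB)
    (Φ := fun z ω => (B ∩ Prod.snd ⁻¹' cell v δ).indicator (fun _ => Z ω) z)
    (memLp_indicator_coeff hBC hZ2) (fun n z ω => ?_) (fun z ω => ?_)
  · rw [abs_le]
    exact ⟨le_max_left _ _, max_le (by linarith [n.cast_nonneg (α := ℝ)]) (min_le_left _ _)⟩
  · by_cases h : z ∈ B ∩ Prod.snd ⁻¹' cell v δ
    · simp only [Set.indicator_of_mem h]
      have hn : (0 : ℝ) ≤ n := n.cast_nonneg
      rcases le_total 0 (Z ω) with h0 | h0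
      · rw [max_eq_right (by linarith [le_min hn h0]), abs_of_nonneg (le_min hn h0),
          abs_of_nonneg h0]
        exact min_le_right _ _
      · rw [min_eq_right (h0.trans hn), abs_of_nonpos (max_le (by linarith) h0), abs_of_nonpos h0]
        linarith [le_max_right (-(n : ℝ)) (Z ω)]
    · simp [Set.indicator_of_notMem h]
  · by_cases h : z ∈ B ∩ Prod.snd ⁻¹' cell v δ
    · simp only [Set.indicator_of_mem h]
      refine tendsto_const_nhds.congr' ?_
      filter_upwards [eventually_ge_atTop ⌈|Z ω|⌉₊] with n hn
      have h1 := (Nat.le_ceil |Z ω|).trans (Nat.cast_le.2 hn)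
      rw [min_eq_right ((le_abs_self _).trans h1), max_eq_right (by linarith [neg_abs_le (Z ω)])]
    · simp [Set.indicator_of_notMem h]

/-- The upper corner of the grid cube of side `(n + 1)⁻¹` with index `k`. -/
noncomputable def gridPoint (n : ℕ) (k : Fin (d + 1) → ℤ) : SpaceTime d := fun i => k i / (n + 1)

/-- The index of the grid cube of side `(n + 1)⁻¹` that contains `s`. -/
noncomputable def gridIndex (n : ℕ) (s : SpaceTime d) : Fin (d + 1) → ℤ := fun i => ⌈s i * (n + 1)⌉

/-- The cells partition space: they are open below and closed above, so the index is given by a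
ceiling. -/
lemma mem_cell_gridPoint_iff (n : ℕ) (k : Fin (d + 1) → ℤ) (s : SpaceTime d) :
    s ∈ cell (gridPoint n k) (1 / (n + 1)) ↔ k = gridIndex n s := by
  have hn : (0 : ℝ) < n + 1 := by positivity
  simp only [cell, gridPoint, gridIndex, Set.mem_ofPred_eq, Set.mem_Ioc, funext_iff]
  refine forall_congr' fun i => ?_
  rw [eq_comm, Int.ceil_eq_iff, ← sub_div, div_lt_iff₀ hn, le_div_iff₀ hn]

variable {σ : SpaceTime d → Ω → ℝ}

/-- On each cell σ is replaced by its value at the lower corner. Stationarity makes the mean square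
error depend only on the displacement, so it is uniformly small over `B`. -/
lemma isAdmissible_indicator_of_bounded (hσ : IsPredictableField 𝓕 σ)
    (hst : IsStrictlyStationary P σ) (hσG : ∀ s, Measurable[𝓖] (σ s))
    (h2 : ∫⁻ ω, ‖σ 0 ω‖ₑ ^ 2 ∂P < ∞) {B : Set (𝒳 × SpaceTime d)}
    (hB : IsBounded (control p d) B) {N : ℕ} (hBN : ∀ z ∈ B, ∀ i, |z.2 i| ≤ N) :
    IsAdmissible 𝓖 p P 𝓕 (fun z ω => B.indicator (fun z => σ z.2 ω) z) := by
  have hσm := hσ.measurable_uncurry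
  have hσ2 : ∀ s, MemLp (σ s) 2 P := fun s => by
    refine ⟨((hσ.measurable_section s).mono (𝓕.le _) le_rfl).aestronglyMeasurable, ?_⟩
    have := hst.lintegral_sq s ▸ h2
    rw [← eLpNorm_two_sq] at this
    exact lt_top_iff_ne_top.2 fun h => by simp [h] at this
  let δ : ℕ → ℝ := fun n => 1 / (n + 1)
  -- Since |sᵢ| ≤ N on `B`, the index ⌈sᵢ(n+1)⌉ lies between ±N(n+1); finitely many cells cover `B`.
  let K : ℕ → Finset (Fin (d + 1) → ℤ) := fun n =>
    Fintype.piFinset fun _ => Finset.Icc (-(N * (n + 1) : ℤ)) (N * (n + 1))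
  -- The lower corner: its time coordinate is the left end of the cell, as adaptedness of the
  -- coefficient requires.
  let pt : ℕ → (Fin (d + 1) → ℤ) → SpaceTime d := fun n k i => gridPoint n k i - δ n
  let u : ℕ → 𝒳 × SpaceTime d → Ω → ℝ := fun n z ω => ∑ k ∈ K n,
    1 * (B ∩ Prod.snd ⁻¹' cell (gridPoint n k) (δ n)).indicator (fun _ => σ (pt n k) ω) z
  have hu : ∀ n, IsAdmissible 𝓖 p P 𝓕 (u n) := fun n =>
    IsAdmissible.sum (K n) _ fun k _ => isAdmissible_inter_cell _ _
      (hσ.measurable_section (pt n k)) (hσG _) (hσ2 _) hB.1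
  have hu1 : ∀ n z ω, u n z ω = B.indicator (fun z => σ (pt n (gridIndex n z.2)) ω) z := by
    intro n z ω
    by_cases hz : z ∈ B
    · have hk : gridIndex n z.2 ∈ K n := by
        simp only [K, Fintype.mem_piFinset, Finset.mem_Icc]
        intro i
        have h1 := abs_le.1 (hBN z hz i)
        have hn : (0 : ℝ) < n + 1 := by positivity
        constructor
        · simp only [gridIndex]
          rw [Int.le_ceil_iff]
          push_cast
          nlinarith
        · simp only [gridIndex]
          rw [Int.ceil_le]
          push_cast
          nlinarith
      have : ∀ k, 1 * (B ∩ Prod.snd ⁻¹' cell (gridPoint n k) (δ n)).indicator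
          (fun _ => σ (pt n k) ω) z = if k = gridIndex n z.2 then σ (pt n k) ω else 0 := by
        intro k
        have := mem_cell_gridPoint_iff n k z.2
        split_ifs with h
        · rw [Set.indicator_of_mem (show _ ∈ _ ∩ _ from ⟨hz, this.2 h⟩), one_mul]
        · rw [Set.indicator_of_notMem (fun h' => h (this.1 h'.2)), mul_zero]
      simp only [u, this, Finset.sum_ite_eq', hk, if_true, Set.indicator_of_mem hz]
    · rw [Set.indicator_of_notMem hz]
      exact Finset.sum_eq_zero fun k _ => by
        rw [Set.indicator_of_notMem (fun h => hz h.1), mul_zero]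
  have hBσ : Measurable fun q : (𝒳 × SpaceTime d) × Ω =>
      B.indicator (fun z => σ z.2 q.2) q.1 :=
    measurable_indicator_uncurry hB.1
      (hσm.comp ((measurable_snd.comp measurable_fst).prodMk measurable_snd))
  refine IsAdmissible.of_tendsto hBσ hu ?_
  rw [ENNReal.tendsto_nhds_zero]
  intro ε hε
  -- Adding 1 to c(B) avoids division by zero when `B` is null.
  have hcB : control p d B + 1 ≠ ∞ := by simpa using hB.2.ne
  have hε' : 0 < ε / (control p d B + 1) := ENNReal.div_pos hε.ne' hcB
  have hcont := (hst.tendsto_lintegral_sub_sq hσm h2).eventually (ge_mem_nhds hε')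
  obtain ⟨r, hr, hrρ⟩ := Metric.eventually_nhds_iff.1 hcont
  have hδ : ∀ᶠ n in atTop, δ n < r :=
    tendsto_one_div_add_atTop_nhds_zero_nat.eventually (gt_mem_nhds hr)
  filter_upwards [hδ] with n hn
  have hdist : ∀ s : SpaceTime d, dist (s - pt n (gridIndex n s)) 0 < r := by
    intro s
    rw [dist_zero_right]
    refine lt_of_le_of_lt ?_ hn
    rw [pi_norm_le_iff_of_nonneg (by positivity)]
    intro i
    have h1 := ((mem_cell_gridPoint_iff n (gridIndex n s) s).2 rfl) i
    simp only [Pi.sub_apply, pt, δ, Real.norm_eq_abs]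
    rw [abs_le]
    exact ⟨by linarith [h1.1, (by positivity : (0 : ℝ) < 1 / (n + 1))], by linarith [h1.2]⟩
  rw [lintegral_prod (fun q : (𝒳 × SpaceTime d) × Ω =>
    ‖B.indicator (fun z => σ z.2 q.2) q.1 - u n q.1 q.2‖ₑ ^ 2) ((hBσ.sub (hu n).1).enorm.pow_const 2).aemeasurable]
  calc _ ≤ ∫⁻ z, B.indicator (fun _ => ε / (control p d B + 1)) z ∂(control p d) := by
        refine lintegral_mono fun z => ?_
        simp only [hu1]
        by_cases hz : z ∈ B
        · simp only [Set.indicator_of_mem hz]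
          have h3 := hst.lintegral_sub_sq (pt n (gridIndex n z.2)) (z.2 - pt n (gridIndex n z.2))
          rw [add_sub_cancel] at h3
          rw [h3]
          exact hrρ (hdist z.2)
        · simp [Set.indicator_of_notMem hz]
    _ = ε / (control p d B + 1) * control p d B := lintegral_indicator_const hB.1 _
    _ ≤ ε / (control p d B + 1) * (control p d B + 1) := by gcongr; simp
    _ = ε := ENNReal.div_mul_cancel (by simp) hcB

end ApproxField

/-! ### From indicators to general kernels. -/

section ApproxProduct

variable {𝒳 Ω : Type*} [MeasurableSpace 𝒳] {𝓖 : MeasurableSpace Ω} {mΩ : MeasurableSpace Ω}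
  {p : Measure 𝒳} {P : Measure Ω} {𝓕 : Filtration ℝ mΩ} {d : ℕ}
  [IsProbabilityMeasure P] {σ : SpaceTime d → Ω → ℝ}

lemma measurable_mul_field (hσm : Measurable fun q : SpaceTime d × Ω => σ q.1 q.2)
    {H : 𝒳 × SpaceTime d → ℝ} (hH : Measurable H) :
    Measurable fun q : (𝒳 × SpaceTime d) × Ω => H q.1 * σ q.1.2 q.2 :=
  (hH.comp measurable_fst).mul
    (hσm.comp ((measurable_snd.comp measurable_fst).prodMk measurable_snd))

/-- The second moment of σ is the same at every point, so approximation of H in L²(c) carries over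
to H·σ. -/
lemma lintegral_mul_field [SFinite p] (hst : IsStrictlyStationary P σ)
    (hσm : Measurable fun q : SpaceTime d × Ω => σ q.1 q.2)
    {H : 𝒳 × SpaceTime d → ℝ} (hH : Measurable H) :
    ∫⁻ q, ‖H q.1 * σ q.1.2 q.2‖ₑ ^ 2 ∂((control p d).prod P) =
      ∫⁻ z, ‖H z‖ₑ ^ 2 * ∫⁻ ω, ‖σ 0 ω‖ₑ ^ 2 ∂P ∂(control p d) := by
  rw [lintegral_prod (fun q : (𝒳 × SpaceTime d) × Ω => ‖H q.1 * σ q.1.2 q.2‖ₑ ^ 2)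
    ((measurable_mul_field hσm hH).enorm.pow_const 2).aemeasurable]
  refine lintegral_congr fun z => ?_
  have hm : Measurable fun ω => ‖σ z.2 ω‖ₑ ^ 2 :=
    (hσm.comp measurable_prodMk_left).enorm.pow_const 2
  simp_rw [enorm_mul, mul_pow]
  rw [lintegral_const_mul _ hm, hst.lintegral_sq z.2]

variable [IsProbabilityMeasure p]

/-- A set of finite measure may be unbounded in space-time; it is exhausted by boxes, with the
integrand itself as majorant. -/
lemma isAdmissible_indicator (hσ : IsPredictableField 𝓕 σ)
    (hst : IsStrictlyStationary P σ) (hσG : ∀ s, Measurable[𝓖] (σ s))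
    (h2 : ∫⁻ ω, ‖σ 0 ω‖ₑ ^ 2 ∂P < ∞) {B : Set (𝒳 × SpaceTime d)}
    (hB : IsBounded (control p d) B) :
    IsAdmissible 𝓖 p P 𝓕 (fun z ω => B.indicator 1 z * σ z.2 ω) := by
  have hσm := hσ.measurable_uncurry
  let box : ℕ → Set (𝒳 × SpaceTime d) := fun N => {z | ∀ i, |z.2 i| ≤ N}
  have hbox : ∀ N, MeasurableSet (box N) := fun N => by
    have : box N = ⋂ i, {z | |z.2 i| ≤ (N : ℝ)} := by ext; simp [box]
    rw [this]
    exact .iInter fun i => measurableSet_le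
      ((measurable_pi_apply i).comp measurable_snd).abs measurable_const
  have hm : Measurable (B.indicator (1 : 𝒳 × SpaceTime d → ℝ)) := measurable_one.indicator hB.1
  refine IsAdmissible.of_dominated (measurable_mul_field hσm hm)
    (fun N => isAdmissible_indicator_of_bounded hσ hst hσG h2 (B := B ∩ box N) (N := N)
      (hB.mono (hB.1.inter (hbox N)) Set.inter_subset_left) fun z hz => hz.2)
    (Φ := fun z ω => B.indicator 1 z * σ z.2 ω)
    ⟨(measurable_mul_field hσm hm).aestronglyMeasurable, ?_⟩ (fun N z ω => ?_) (fun z ω => ?_)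
  · have h : ∫⁻ q, ‖B.indicator 1 q.1 * σ q.1.2 q.2‖ₑ ^ 2 ∂((control p d).prod P) < ∞ := by
      rw [lintegral_mul_field hst hσm hm, lintegral_mul_const _ (hm.enorm.pow_const 2)]
      refine ENNReal.mul_lt_top ?_ h2
      have : ∀ z, ‖B.indicator (1 : 𝒳 × SpaceTime d → ℝ) z‖ₑ ^ 2 = B.indicator 1 z := fun z => by
        by_cases hz : z ∈ B <;> simp [hz]
      simp_rw [this]
      rw [lintegral_indicator_one hB.1]
      exact hB.2
    rw [← eLpNorm_two_sq] at h
    exact lt_top_iff_ne_top.2 fun h' => by simp [h'] at h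
  · by_cases hz : z ∈ B
    · by_cases hN : z ∈ box N
      · rw [Set.indicator_of_mem (show z ∈ B ∩ box N from ⟨hz, hN⟩)]; simp [hz]
      · rw [Set.indicator_of_notMem (fun h : z ∈ B ∩ box N => hN h.2), abs_zero]
        exact abs_nonneg _
    · rw [Set.indicator_of_notMem (fun h : z ∈ B ∩ box N => hz h.1), abs_zero]
      exact abs_nonneg _
  · by_cases hz : z ∈ B
    · refine tendsto_const_nhds.congr' ?_
      filter_upwards [eventually_ge_atTop ⌈‖z.2‖⌉₊] with N hN
      have hzN : z ∈ B ∩ box N :=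
        ⟨hz, fun i => (norm_le_pi_norm z.2 i).trans ((Nat.le_ceil _).trans (Nat.cast_le.2 hN))⟩
      rw [Set.indicator_of_mem hzN, Set.indicator_of_mem hz, Pi.one_apply, one_mul]
    · rw [Set.indicator_of_notMem hz, zero_mul]
      refine tendsto_const_nhds.congr fun N => ?_
      rw [Set.indicator_of_notMem (fun h : z ∈ B ∩ box N => hz h.1)]

lemma isAdmissible_mul_of_memLp (hσ : IsPredictableField 𝓕 σ)
    (hst : IsStrictlyStationary P σ) (hσG : ∀ s, Measurable[𝓖] (σ s))
    (h2 : ∫⁻ ω, ‖σ 0 ω‖ₑ ^ 2 ∂P < ∞) {H : 𝒳 × SpaceTime d → ℝ} (hH : Measurable H)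
    (hH2 : MemLp H 2 (control p d)) : IsAdmissible 𝓖 p P 𝓕 (fun z ω => H z * σ z.2 ω) := by
  have hσm := hσ.measurable_uncurry
  have hex : ∀ n : ℕ, ∃ G : SimpleFunc (𝒳 × SpaceTime d) ℝ,
      eLpNorm (fun z => H z - G z) 2 (control p d) < (n + 1 : ℝ≥0∞)⁻¹ ∧ MemLp G 2 (control p d) := fun n =>
    hH2.exists_simpleFunc_eLpNorm_sub_lt (by norm_num) (by simp)
  choose G hG hG2 using hex
  have hadm : ∀ n, IsAdmissible 𝓖 p P 𝓕 (fun z ω => G n z * σ z.2 ω) := by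
    intro n
    have hs : ∀ z, G n z =
        ∑ r ∈ (G n).range with r ≠ 0, r * ((G n) ⁻¹' {r}).indicator 1 z := by
      intro z
      rw [Finset.sum_filter_of_ne (fun r _ h => left_ne_zero_of_mul h),
        Finset.sum_eq_single (G n z)]
      · simp
      · intro r _ hr
        rw [Set.indicator_of_notMem (fun h => hr h.symm), mul_zero]
      · intro h; exact absurd (SimpleFunc.mem_range_self _ z) h
    refine (IsAdmissible.sum ((G n).range.filter (· ≠ 0)) id fun r hr =>
      isAdmissible_indicator hσ hst hσG h2 (B := (G n) ⁻¹' {r}) ⟨(G n).measurableSet_fiber r,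
        SimpleFunc.measure_preimage_lt_top_of_memLp (by norm_num) (by norm_num) (G n) (hG2 n) r
          (Finset.mem_filter.1 hr).2⟩).congr fun z ω => ?_
    rw [hs z, Finset.sum_mul]
    exact Finset.sum_congr rfl fun r _ => (mul_assoc _ _ _).symm
  refine IsAdmissible.of_tendsto (measurable_mul_field hσm hH) hadm ?_
  have hlim : Tendsto (fun n => eLpNorm (fun z => H z - G n z) 2 (control p d) ^ 2 *
      ∫⁻ ω, ‖σ 0 ω‖ₑ ^ 2 ∂P) atTop (𝓝 0) := by
    have h0 : Tendsto (fun n => eLpNorm (fun z => H z - G n z) 2 (control p d)) atTop (𝓝 0) := by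
      refine tendsto_of_tendsto_of_tendsto_of_le_of_le tendsto_const_nhds
        ((ENNReal.tendsto_inv_nat_nhds_zero).comp (tendsto_add_atTop_nat 1))
        (fun _ => zero_le) fun n => ?_
      simpa using (hG n).le
    have h1 := ENNReal.Tendsto.mul_const (ENNReal.Tendsto.pow (n := 2) h0) (Or.inr h2.ne)
    simpa using h1
  refine hlim.congr fun n => ?_
  have hm : Measurable (fun z => H z - G n z) := hH.sub (G n).measurable
  have h3 := lintegral_mul_field (p := p) hst hσm hm
  rw [lintegral_mul_const _ (hm.enorm.pow_const 2), ← eLpNorm_two_sq (fun z => H z - G n z)] at h3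
  simp_rw [← sub_mul]
  exact h3.symm

/-- Only the product of ∫ H² dc and E σ(0)² is assumed finite. If the second factor is 0, or is ∞
and so forces the first to vanish, then the integrand is null and 0 approximates it. Otherwise H is
in L². -/
lemma isAdmissible_mul (hσ : IsPredictableField 𝓕 σ)
    (hst : IsStrictlyStationary P σ) (hσG : ∀ s, Measurable[𝓖] (σ s))
    {H : 𝒳 × SpaceTime d → ℝ} (hH : Measurable H)
    (hfin : ∫⁻ z, ‖H z‖ₑ ^ 2 * ∫⁻ ω, ‖σ 0 ω‖ₑ ^ 2 ∂P ∂(control p d) < ∞) :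
    IsAdmissible 𝓖 p P 𝓕 (fun z ω => H z * σ z.2 ω) := by
  have hσm := hσ.measurable_uncurry
  have hm2 : Measurable fun z => ‖H z‖ₑ ^ 2 := hH.enorm.pow_const 2
  have hdeg : ∫⁻ z, ‖H z‖ₑ ^ 2 * ∫⁻ ω, ‖σ 0 ω‖ₑ ^ 2 ∂P ∂(control p d) = 0 →
      IsAdmissible 𝓖 p P 𝓕 (fun z ω => H z * σ z.2 ω) := by
    intro h
    refine IsAdmissible.of_tendsto (measurable_mul_field hσm hH) (fun _ => isAdmissible_zero) ?_
    simp_rw [sub_zero]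
    rw [lintegral_mul_field hst hσm hH, h]
    exact tendsto_const_nhds
  set m := ∫⁻ ω, ‖σ 0 ω‖ₑ ^ 2 ∂P
  by_cases h0 : m = 0
  · exact hdeg (by simp [h0])
  by_cases ht : m = ∞
  · refine hdeg ?_
    rw [lintegral_mul_const _ hm2, ht] at hfin ⊢
    by_contra hne
    rw [ENNReal.mul_top (left_ne_zero_of_mul hne)] at hfin
    exact lt_irrefl _ hfin
  · refine isAdmissible_mul_of_memLp hσ hst hσG (lt_top_iff_ne_top.2 ht) hH
      ⟨hH.aestronglyMeasurable, ?_⟩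
    rw [lintegral_mul_const _ hm2, ← eLpNorm_two_sq] at hfin
    refine lt_top_iff_ne_top.2 fun h' => ?_
    rw [h'] at hfin
    simp [ENNReal.top_mul h0] at hfin

end ApproxProduct

/-! ### Integral functionals and finite-dimensional distributions. -/

section Functional

variable {T E Ω : Type*} [MeasurableSpace T] [MeasurableSpace E] {mΩ : MeasurableSpace Ω}
  {P : Measure Ω} [IsProbabilityMeasure P] {σ τ : T → Ω → ℝ}

/-- The moments of `∫ f(z, σ(π z)) μ(dz)` are determined by the finite-dimensional distributions
of `σ`. -/
lemma integral_pow_integral_eq {μ : Measure E} [IsFiniteMeasure μ]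
    (hσ : Measurable fun q : T × Ω => σ q.1 q.2) (hτ : Measurable fun q : T × Ω => τ q.1 q.2)
    (h : ∀ (n : ℕ) (t : Fin n → T),
      IdentDistrib (fun ω i => σ (t i) ω) (fun ω i => τ (t i) ω) P P)
    {π : E → T} (hπ : Measurable π) {f : E × ℝ → ℝ} (hf : Measurable f) {C : ℝ}
    (hC : ∀ x, |f x| ≤ C) (k : ℕ) :
    ∫ ω, (∫ z, f (z, σ (π z) ω) ∂μ) ^ k ∂P = ∫ ω, (∫ z, f (z, τ (π z) ω) ∂μ) ^ k ∂P := by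
  -- The k-th power of an integral is an integral over k-tuples of points; Fubini moves the
  -- expectation inside, where only k values of the field occur.
  have key : ∀ {ρ : T → Ω → ℝ}, Measurable (fun q : T × Ω => ρ q.1 q.2) →
      ∫ ω, (∫ z, f (z, ρ (π z) ω) ∂μ) ^ k ∂P =
        ∫ x : Fin k → E, ∫ ω, ∏ i, f (x i, ρ (π (x i)) ω) ∂P ∂(Measure.pi fun _ => μ) := by
    intro ρ hρ
    have hm : Measurable fun q : Ω × (Fin k → E) => ∏ i, f (q.2 i, ρ (π (q.2 i)) q.1) := by
      refine Finset.measurable_fun_prod _ fun i _ => hf.comp ?_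
      have h1 : Measurable fun q : Ω × (Fin k → E) => q.2 i :=
        (measurable_pi_apply i).comp measurable_snd
      exact h1.prodMk (hρ.comp ((hπ.comp h1).prodMk measurable_fst))
    rw [← integral_integral_swap]
    · refine integral_congr_ae (ae_of_all _ fun ω => ?_)
      have := integral_fintype_prod_eq_pow (ι := Fin k) (μ := μ) (fun z => f (z, ρ (π z) ω))
      simpa using this.symm
    · refine Integrable.of_bound hm.aestronglyMeasurable (C ^ k) (ae_of_all _ fun q => ?_)
      simp only [Function.uncurry, Real.norm_eq_abs, Finset.abs_prod]
      calc _ ≤ ∏ _i : Fin k, C := Finset.prod_le_prod (fun _ _ => abs_nonneg _) fun _ _ => hC _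
        _ = C ^ k := by simp
  rw [key hσ, key hτ]
  refine integral_congr_ae (ae_of_all _ fun x => ?_)
  exact ((h k fun i => π (x i)).comp (u := fun y : Fin k → ℝ => ∏ i, f (x i, y i))
    (Finset.measurable_fun_prod _ fun i _ =>
      hf.comp (measurable_const.prodMk (measurable_pi_apply i)))).integral_eq

/-- Boundedness of Z justifies termwise expectation of the exponential series, which reduces
exponential expectations to moments. -/
lemma integral_exp_eq_tsum {Z : Ω → ℝ} (hZ : Measurable Z) {C : ℝ} (hC : ∀ ω, |Z ω| ≤ C) :
    ∫ ω, Real.exp (Z ω) ∂P = ∑' k : ℕ, ∫ ω, Z ω ^ k / k.factorial ∂P := by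
  have hb : ∀ k ω, ‖Z ω ^ k / (k.factorial : ℝ)‖ ≤ C ^ k / k.factorial := fun k ω => by
    rw [norm_div, norm_pow, Real.norm_eq_abs, Real.norm_natCast]
    gcongr
    exact hC ω
  have hi : ∀ k : ℕ, Integrable (fun ω => Z ω ^ k / (k.factorial : ℝ)) P := fun k =>
    Integrable.of_bound ((hZ.pow_const k).div_const _).aestronglyMeasurable _
      (ae_of_all _ (hb k))
  have hs := hasSum_integral_of_summable_integral_norm hi (by
    refine Summable.of_nonneg_of_le (fun k => integral_nonneg fun _ => norm_nonneg _) (fun k => ?_)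
      (Real.summable_pow_div_factorial C)
    have := integral_mono (hi k).norm (integrable_const (C ^ k / (k.factorial : ℝ))) (hb k)
    simpa using this)
  rw [hs.tsum_eq]
  refine integral_congr_ae (ae_of_all _ fun ω => ?_)
  simp only [Real.exp_eq_exp_ℝ, NormedSpace.exp_eq_tsum_div]

lemma integral_exp_integral_eq_of_bounded {μ : Measure E} [IsFiniteMeasure μ]
    (hσ : Measurable fun q : T × Ω => σ q.1 q.2) (hτ : Measurable fun q : T × Ω => τ q.1 q.2)
    (h : ∀ (n : ℕ) (t : Fin n → T),
      IdentDistrib (fun ω i => σ (t i) ω) (fun ω i => τ (t i) ω) P P)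
    {π : E → T} (hπ : Measurable π) {f : E × ℝ → ℝ} (hf : Measurable f) {C : ℝ}
    (hC : ∀ x, |f x| ≤ C) :
    ∫ ω, Real.exp (∫ z, f (z, σ (π z) ω) ∂μ) ∂P =
      ∫ ω, Real.exp (∫ z, f (z, τ (π z) ω) ∂μ) ∂P := by
  have hm : ∀ {ρ : T → Ω → ℝ}, Measurable (fun q : T × Ω => ρ q.1 q.2) →
      Measurable fun ω => ∫ z, f (z, ρ (π z) ω) ∂μ := fun {ρ} hρ => by
    have h1 : Measurable fun q : Ω × E => f (q.2, ρ (π q.2) q.1) :=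
      hf.comp (measurable_snd.prodMk (hρ.comp ((hπ.comp measurable_snd).prodMk measurable_fst)))
    exact (h1.stronglyMeasurable.integral_prod_right' (ν := μ)).measurable
  have hb : ∀ (ρ : T → Ω → ℝ) ω, |∫ z, f (z, ρ (π z) ω) ∂μ| ≤ C * μ.real Set.univ :=
    fun ρ ω => by
      rw [← Real.norm_eq_abs]
      exact norm_integral_le_of_norm_le_const (ae_of_all _ fun z => hC _)
  rw [integral_exp_eq_tsum (hm hσ) (hb σ), integral_exp_eq_tsum (hm hτ) (hb τ)]
  refine tsum_congr fun k => ?_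
  rw [integral_div, integral_div, integral_pow_integral_eq hσ hτ h hπ hf hC k]

/-- The law of `∫ H(z)² σ(π z)² μ(dz)` is determined by the finite-dimensional distributions of
`σ`. -/
lemma integral_exp_neg_integral_sq_eq {μ : Measure E} [SigmaFinite μ]
    (hσ : Measurable fun q : T × Ω => σ q.1 q.2) (hτ : Measurable fun q : T × Ω => τ q.1 q.2)
    (h : ∀ (n : ℕ) (t : Fin n → T),
      IdentDistrib (fun ω i => σ (t i) ω) (fun ω i => τ (t i) ω) P P)
    {π : E → T} (hπ : Measurable π) {H : E → ℝ} (hH : Measurable H)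
    (hσi : ∀ᵐ ω ∂P, Integrable (fun z => (H z * σ (π z) ω) ^ 2) μ)
    (hτi : ∀ᵐ ω ∂P, Integrable (fun z => (H z * τ (π z) ω) ^ 2) μ) :
    ∫ ω, Real.exp (-(∫ z, (H z * σ (π z) ω) ^ 2 ∂μ) / 2) ∂P =
      ∫ ω, Real.exp (-(∫ z, (H z * τ (π z) ω) ^ 2 ∂μ) / 2) ∂P := by
  -- Capping the square at n, and restricting the measure to a spanning set of finite measure,
  -- brings the functional within the bounded case; dominated convergence, applied twice, removes
  -- both.
  let f : ℕ → E × ℝ → ℝ := fun n x => -(min ((H x.1 * x.2) ^ 2) n) / 2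
  have hf : ∀ n, Measurable (f n) := fun n => by
    have : Measurable fun x : E × ℝ => (H x.1 * x.2) ^ 2 :=
      ((hH.comp measurable_fst).mul measurable_snd).pow_const 2
    exact ((this.min measurable_const).neg).div_const 2
  have hfb : ∀ n x, |f n x| ≤ n := fun n x => by
    have h0 : 0 ≤ min ((H x.1 * x.2) ^ 2) (n : ℝ) := le_min (sq_nonneg _) n.cast_nonneg
    have h1 : min ((H x.1 * x.2) ^ 2) (n : ℝ) ≤ n := min_le_right _ _
    simp only [f]
    rw [abs_le]
    constructor <;> linarith
  have key : ∀ {ρ : T → Ω → ℝ}, Measurable (fun q : T × Ω => ρ q.1 q.2) →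
      (∀ᵐ ω ∂P, Integrable (fun z => (H z * ρ (π z) ω) ^ 2) μ) →
      Tendsto (fun n => ∫ ω, Real.exp
        (∫ z, f n (z, ρ (π z) ω) ∂(μ.restrict (spanningSets μ n))) ∂P) atTop
        (𝓝 (∫ ω, Real.exp (-(∫ z, (H z * ρ (π z) ω) ^ 2 ∂μ) / 2) ∂P)) := by
    intro ρ hρ hρi
    have hmf : ∀ n, Measurable fun q : Ω × E => f n (q.2, ρ (π q.2) q.1) := fun n =>
      (hf n).comp (measurable_snd.prodMk
        (hρ.comp ((hπ.comp measurable_snd).prodMk measurable_fst)))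
    have hle : ∀ n x, f n x ≤ 0 := fun n x => by
      have h0 : 0 ≤ min ((H x.1 * x.2) ^ 2) (n : ℝ) := le_min (sq_nonneg _) n.cast_nonneg
      simp only [f]; linarith
    refine tendsto_integral_of_dominated_convergence (fun _ => 1) (fun n => ?_)
      (integrable_const 1) (fun n => ae_of_all _ fun ω => ?_) ?_
    · exact ((hmf n).stronglyMeasurable.integral_prod_right'
        (ν := μ.restrict (spanningSets μ n))).measurable.exp.aestronglyMeasurable
    · rw [Real.norm_eq_abs, Real.abs_exp, Real.exp_le_one_iff]
      exact integral_nonpos fun z => hle n _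
    · filter_upwards [hρi] with ω hω
      refine (Real.continuous_exp.tendsto _).comp ?_
      have hlim : Tendsto (fun n => ∫ z, (spanningSets μ n).indicator
          (fun z => f n (z, ρ (π z) ω)) z ∂μ) atTop
          (𝓝 (∫ z, -(H z * ρ (π z) ω) ^ 2 / 2 ∂μ)) := by
        refine tendsto_integral_of_dominated_convergence (fun z => (H z * ρ (π z) ω) ^ 2)
          (fun n => ?_) hω (fun n => ae_of_all _ fun z => ?_) (ae_of_all _ fun z => ?_)
        · exact (((hmf n).comp measurable_prodMk_left).indicator
            (measurableSet_spanningSets μ n)).aestronglyMeasurable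
        · by_cases hz : z ∈ spanningSets μ n
          · rw [Set.indicator_of_mem hz, Real.norm_eq_abs, abs_of_nonpos (hle n _)]
            have h1 : min ((H z * ρ (π z) ω) ^ 2) (n : ℝ) ≤ (H z * ρ (π z) ω) ^ 2 :=
              min_le_left _ _
            simp only [f]
            nlinarith [sq_nonneg (H z * ρ (π z) ω)]
          · rw [Set.indicator_of_notMem hz, norm_zero]; exact sq_nonneg _
        · refine tendsto_const_nhds.congr' ?_
          filter_upwards [eventually_ge_atTop (spanningSetsIndex μ z),
            eventually_ge_atTop ⌈(H z * ρ (π z) ω) ^ 2⌉₊] with n h1 h2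
          have hz : z ∈ spanningSets μ n :=
            monotone_spanningSets μ h1 (mem_spanningSetsIndex μ z)
          rw [Set.indicator_of_mem hz]
          simp only [f]
          rw [min_eq_left ((Nat.le_ceil _).trans (Nat.cast_le.2 h2))]
      rw [integral_div, integral_neg] at hlim
      exact hlim.congr fun n => integral_indicator (measurableSet_spanningSets μ n)
  have : ∀ n, IsFiniteMeasure (μ.restrict (spanningSets μ n)) := fun n =>
    ⟨by simpa using measure_spanningSets_lt_top μ n⟩
  refine tendsto_nhds_unique (key hσ hσi) ((key hτ hτi).congr fun n => ?_)
  exact (integral_exp_integral_eq_of_bounded hσ hτ h hπ (hf n) (hfb n)).symm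

end Functional

/-! ### Stationarity of the moving average field. -/

section Stationarity

/-- Equality of the one-dimensional characteristic functions of all linear combinations implies
equality of the joint laws. -/
lemma identDistrib_of_integral_exp_eq {Ω : Type*} {mΩ : MeasurableSpace Ω} {P : Measure Ω}
    [IsProbabilityMeasure P] {n : ℕ} {X Y : Fin n → Ω → ℝ} (hX : ∀ i, AEMeasurable (X i) P)
    (hY : ∀ i, AEMeasurable (Y i) P)
    (h : ∀ r : Fin n → ℝ, ∫ ω, Complex.exp (((∑ i, r i * X i ω : ℝ) : ℂ) * Complex.I) ∂P =
      ∫ ω, Complex.exp (((∑ i, r i * Y i ω : ℝ) : ℂ) * Complex.I) ∂P) :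
    IdentDistrib (fun ω i => X i ω) (fun ω i => Y i ω) P P := by
  have hX' : AEMeasurable (fun ω i => X i ω) P := aemeasurable_pi_lambda _ hX
  have hY' : AEMeasurable (fun ω i => Y i ω) P := aemeasurable_pi_lambda _ hY
  refine ⟨hX', hY', Measure.ext_of_charFunDual (funext fun L => ?_)⟩
  -- Every functional on the finite-dimensional space is a combination of coordinates, so the
  -- hypothesis covers all of its characteristic function.
  have hL : ∀ v : Fin n → ℝ, L v = ∑ i, L (Pi.single i 1) * v i := fun v => by
    conv_lhs => rw [pi_eq_sum_univ' v]
    simp [map_sum, mul_comm]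
  have hm : ∀ μ : Measure (Fin n → ℝ), AEStronglyMeasurable
      (fun v : Fin n → ℝ => Complex.exp ((L v : ℂ) * Complex.I)) μ := fun μ =>
    Continuous.aestronglyMeasurable (by fun_prop)
  rw [charFunDual_apply, charFunDual_apply, integral_map hX' (hm _), integral_map hY' (hm _)]
  have hX_lin : ∀ ω, L (fun i => X i ω) = ∑ i, L (Pi.single i 1) * X i ω := fun ω => hL _
  have hY_lin : ∀ ω, L (fun i => Y i ω) = ∑ i, L (Pi.single i 1) * Y i ω := fun ω => hL _
  exact (integral_congr_ae (ae_of_all _ fun ω => by simp only [hX_lin])).trans ((h fun i => L (Pi.single i 1)).trans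
    (integral_congr_ae (ae_of_all _ fun ω => by simp only [hY_lin])))

lemma IsStrictlyStationary.isSecondOrderStationary {T Ω : Type*} [Add T] {mΩ : MeasurableSpace Ω}
    {P : Measure Ω} {X : T → Ω → ℝ} (h : IsStrictlyStationary P X) (h2 : ∀ t, MemLp (X t) 2 P) :
    IsSecondOrderStationary P X := by
  have hmean : ∀ t v, ∫ ω, X (t + v) ω ∂P = ∫ ω, X t ω ∂P := fun t v => by
    have := (h 1 (fun _ => t) v).comp (u := fun x : Fin 1 → ℝ => x 0) (by fun_prop)
    simpa [Function.comp_def] using this.integral_eq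
  refine ⟨h2, hmean, fun t u v => ?_⟩
  rw [covariance, covariance, hmean, hmean]
  have := (h 2 ![t, u] v).comp
    (u := fun x : Fin 2 → ℝ => (x 0 - ∫ ω, X t ω ∂P) * (x 1 - ∫ ω, X u ω ∂P)) (by fun_prop)
  simpa [Function.comp_def] using this.integral_eq

variable {𝒳 Ω : Type*} [MeasurableSpace 𝒳] {mΩ : MeasurableSpace Ω}
  {p : Measure 𝒳} {P : Measure Ω} {𝓕 : Filtration ℝ mΩ} {d : ℕ}
  {W : Set (𝒳 × SpaceTime d) → Ω → ℝ} {g : 𝒳 → SpaceTime d → ℝ} {σ : SpaceTime d → Ω → ℝ}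

lemma measurable_kernel (hg : Measurable (Function.uncurry g)) (t : SpaceTime d) :
    Measurable fun z : 𝒳 × SpaceTime d => g z.1 (t - z.2) := by
  have h : Measurable fun z : 𝒳 × SpaceTime d => (z.1, t - z.2) :=
    measurable_fst.prodMk ((measurable_const_sub t).comp measurable_snd)
  exact hg.comp h

/-- The translation of the space-time coordinate. -/
def shift (v : SpaceTime d) : 𝒳 × SpaceTime d ≃ᵐ 𝒳 × SpaceTime d :=
  (MeasurableEquiv.refl 𝒳).prodCongr (MeasurableEquiv.addRight v)

lemma shift_apply (v : SpaceTime d) (z : 𝒳 × SpaceTime d) : shift v z = (z.1, z.2 + v) := rfl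

lemma measurePreserving_shift [SFinite p] (v : SpaceTime d) :
    MeasurePreserving (shift (𝒳 := 𝒳) v) (control p d) (control p d) :=
  (MeasurePreserving.id p).prod (measurePreserving_add_right volume v)

lemma lintegral_kernel_lt_top (hst : IsStrictlyStationary P σ)
    (hI2 : ∀ t : SpaceTime d,
      ∫⁻ z, ENNReal.ofReal (g z.1 (t - z.2) ^ 2) * (∫⁻ ω, ENNReal.ofReal (σ z.2 ω ^ 2) ∂P)
        ∂(control p d) < ∞) (t : SpaceTime d) :
    ∫⁻ z : 𝒳 × SpaceTime d, ‖g z.1 (t - z.2)‖ₑ ^ 2 * ∫⁻ ω, ‖σ 0 ω‖ₑ ^ 2 ∂P ∂(control p d) < ∞ := by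
  have e : ∀ x : ℝ, ENNReal.ofReal (x ^ 2) = ‖x‖ₑ ^ 2 := fun x => by
    rw [← enorm_pow, Real.enorm_of_nonneg (sq_nonneg _)]
  have h := hI2 t
  simp_rw [e, hst.lintegral_sq] at h
  exact h

variable [IsProbabilityMeasure p] [IsProbabilityMeasure P]

/-- The characteristic function of a linear combination of values of the moving average field. -/
lemma IsVMMMA.integral_exp (hW : IsGaussianBasis (control p d) P W)
    (h𝓕 : IsNoiseFiltration p P W 𝓕) (hg : Measurable (Function.uncurry g))
    (hσ : IsPredictableField 𝓕 σ)
    (hind : IndepOfBasis (control p d) P W σ)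
    (hadm : ∀ t, IsAdmissible (MeasurableSpace.comap (fun ω s => σ s ω) inferInstance) p P 𝓕
      fun z ω => g z.1 (t - z.2) * σ z.2 ω)
    {X : SpaceTime d → Ω → ℝ} (hX : IsVMMMA p P 𝓕 W g σ X) {n : ℕ} (t : Fin n → SpaceTime d)
    (r : Fin n → ℝ) :
    MemLp (fun q : (𝒳 × SpaceTime d) × Ω => (∑ i, r i * g q.1.1 (t i - q.1.2)) * σ q.1.2 q.2) 2
        ((control p d).prod P) ∧
    ∫ ω, Complex.exp (((∑ i, r i * X (t i) ω : ℝ) : ℂ) * Complex.I) ∂P =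
      ((∫ ω, Real.exp (-(∫ z, ((∑ i, r i * g z.1 (t i - z.2)) * σ z.2 ω) ^ 2 ∂(control p d)) / 2)
        ∂P : ℝ) : ℂ) := by
  -- By linearity the combination of the X(tᵢ) is itself a Walsh integral, of a single kernel times
  -- σ.
  have hsum := IsWalshIntegralOf.sum hW Finset.univ r
    (fun i => (hadm (t i)).1.aestronglyMeasurable)
    (fun i => (hX (t i)).isWalshIntegralOf hW h𝓕 (hadm (t i)).1.aestronglyMeasurable (hadm (t i)).2)
  have e : (fun (z : 𝒳 × SpaceTime d) ω => ∑ i, r i * (g z.1 (t i - z.2) * σ z.2 ω)) =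
      fun z ω => (∑ i, r i * g z.1 (t i - z.2)) * σ z.2 ω := by
    ext z ω
    simp_rw [Finset.sum_mul, mul_assoc]
  rw [e] at hsum
  have hm : Measurable fun z : 𝒳 × SpaceTime d => ∑ i, r i * g z.1 (t i - z.2) :=
    Finset.measurable_fun_sum _ fun i _ => (measurable_kernel hg (t i)).const_mul (r i)
  have hφ := (measurable_mul_field hσ.measurable_uncurry hm).aestronglyMeasurable
    (μ := (control p d).prod P)
  refine ⟨hsum.memLp hφ, ?_⟩
  rw [hsum.integral_exp hW hind hφ]
  exact integral_ofReal (𝕜 := ℂ)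

lemma IsVMMMA.isStrictlyStationary (hW : IsGaussianBasis (control p d) P W)
    (h𝓕 : IsNoiseFiltration p P W 𝓕) (hg : Measurable (Function.uncurry g))
    (hσ : IsPredictableField 𝓕 σ) (hst : IsStrictlyStationary P σ)
    (hind : IndepOfBasis (control p d) P W σ)
    (hadm : ∀ t, IsAdmissible (MeasurableSpace.comap (fun ω s => σ s ω) inferInstance) p P 𝓕
      fun z ω => g z.1 (t - z.2) * σ z.2 ω)
    {X : SpaceTime d → Ω → ℝ} (hX : IsVMMMA p P 𝓕 W g σ X) : IsStrictlyStationary P X := by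
  intro n t v
  refine identDistrib_of_integral_exp_eq (fun i => (hX _).1.aestronglyMeasurable.aemeasurable)
    (fun i => (hX _).1.aestronglyMeasurable.aemeasurable) fun r => ?_
  obtain ⟨h1, e1⟩ := hX.integral_exp hW h𝓕 hg hσ hind hadm (fun i => t i + v) r
  obtain ⟨h2, e2⟩ := hX.integral_exp hW h𝓕 hg hσ hind hadm t r
  have hσm := hσ.measurable_uncurry
  have hm : Measurable fun z : 𝒳 × SpaceTime d => ∑ i, r i * g z.1 (t i - z.2) :=
    Finset.measurable_fun_sum _ fun i _ => (measurable_kernel hg (t i)).const_mul (r i)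
  have hshift : ∀ ω (z : 𝒳 × SpaceTime d),
      ((∑ i, r i * g (shift v z).1 (t i + v - (shift v z).2)) * σ (shift v z).2 ω) ^ 2 =
        ((∑ i, r i * g z.1 (t i - z.2)) * σ (z.2 + v) ω) ^ 2 := fun ω z => by
    simp only [shift_apply, add_sub_add_right_eq_sub]
  have hτm : Measurable fun q : SpaceTime d × Ω => σ (q.1 + v) q.2 := by
    have hv : Measurable fun q : SpaceTime d × Ω => (q.1 + v, q.2) :=
      ((measurable_add_const v).comp measurable_fst).prodMk measurable_snd
    exact hσm.comp hv
  rw [e1, e2]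
  congr 1
  -- Changing variables by `shift v`, which preserves c, restores the kernel at the tᵢ and replaces
  -- σ by σ(· + v), a field with the same finite-dimensional distributions.
  refine Eq.trans ?_ (integral_exp_neg_integral_sq_eq (μ := control p d) (σ := σ)
    (τ := fun s => σ (s + v)) hσm hτm (fun n t => (hst n t v).symm) measurable_snd hm
    h2.integrable_sq.prod_left_ae ?_).symm
  · refine integral_congr_ae (ae_of_all _ fun ω => ?_)
    simp only
    rw [← (measurePreserving_shift v).integral_comp (shift v).measurableEmbedding]
    simp_rw [hshift]
  · filter_upwards [h1.integrable_sq.prod_left_ae] with ω hω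
    have := ((measurePreserving_shift v).integrable_comp_emb
      (shift v).measurableEmbedding).2 hω
    simpa only [Function.comp_def, hshift] using this

end Stationarity

end VMMMA

theorem mainTheorem6 {𝒳 Ω : Type*} [MeasurableSpace 𝒳] {mΩ : MeasurableSpace Ω} {d : ℕ}
    (p : Measure 𝒳) [IsProbabilityMeasure p] (P : Measure Ω) [IsProbabilityMeasure P]
    (W : Set (𝒳 × VMMMA.SpaceTime d) → Ω → ℝ)
    (hW : VMMMA.IsGaussianBasis (VMMMA.control p d) P W)
    (𝓕 : Filtration ℝ mΩ) (h𝓕 : VMMMA.IsNoiseFiltration p P W 𝓕)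
    (g : 𝒳 → VMMMA.SpaceTime d → ℝ) (hg : Measurable (Function.uncurry g))
    (σ : VMMMA.SpaceTime d → Ω → ℝ)
    (hσ_pred : VMMMA.IsPredictableField 𝓕 σ)
    (hσ_stat : VMMMA.IsStrictlyStationary P σ)
    (hσ_indep : VMMMA.IndepOfBasis (VMMMA.control p d) P W σ)
    (hI2 : ∀ t : VMMMA.SpaceTime d,
      ∫⁻ z, ENNReal.ofReal (g z.1 (t - z.2) ^ 2) * (∫⁻ ω, ENNReal.ofReal (σ z.2 ω ^ 2) ∂P)
        ∂(VMMMA.control p d) < ∞) :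
    (∃ X : VMMMA.SpaceTime d → Ω → ℝ, VMMMA.IsVMMMA p P 𝓕 W g σ X) ∧
    (∀ X X' : VMMMA.SpaceTime d → Ω → ℝ, VMMMA.IsVMMMA p P 𝓕 W g σ X →
      VMMMA.IsVMMMA p P 𝓕 W g σ X' → ∀ t, X t =ᵐ[P] X' t) ∧
    (∀ X : VMMMA.SpaceTime d → Ω → ℝ, VMMMA.IsVMMMA p P 𝓕 W g σ X →
      VMMMA.IsStrictlyStationary P X ∧ VMMMA.IsSecondOrderStationary P X) := by
  -- Here 𝓖 is the σ-algebra generated by the field σ, which is independent of W.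
  have hadm : ∀ t, VMMMA.IsAdmissible (MeasurableSpace.comap (fun ω s => σ s ω) inferInstance)
      p P 𝓕 fun z ω => g z.1 (t - z.2) * σ z.2 ω := fun t =>
    VMMMA.isAdmissible_mul hσ_pred hσ_stat
      (fun s => (measurable_pi_apply (X := fun _ : VMMMA.SpaceTime d => ℝ) s).comp
        (comap_measurable _))
      (VMMMA.measurable_kernel hg t) (VMMMA.lintegral_kernel_lt_top hσ_stat hI2 t)
  have hX : ∀ t, ∃ I, VMMMA.IsWalshIntegral p P 𝓕 W (fun z ω => g z.1 (t - z.2) * σ z.2 ω) I :=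
    fun t => VMMMA.exists_isWalshIntegral hW h𝓕 (hadm t).1.aestronglyMeasurable (hadm t).2
  refine ⟨⟨fun t => (hX t).choose, fun t => (hX t).choose_spec⟩,
    fun X X' h h' t => (h t).ae_eq hW h𝓕 (hadm t).1.aestronglyMeasurable (h' t),
    fun X h => ?_⟩
  have hs := h.isStrictlyStationary hW h𝓕 hg hσ_pred hσ_stat hσ_indep hadm
  exact ⟨hs, hs.isSecondOrderStationary fun t => (h t).1⟩
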